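/- Let $n,p\in\mathbb N$, let $X\in\mathbb R^{n\times p}$ have rows $X_1^T,\dots,X_n^T$ and full row rank ($\operatorname{rank}X=n$), let $Y\in\{0,1\}^n$, let $v\in\mathbb R^p$, and let $Q\in\mathbb R^{p\times p}$ be symmetric positive definite. Let $\phi,\Phi$ be the density and distribution function of $\mathrm N(0,1)$, let $$\pi(\beta)\;\propto\;\Big\{\prod_{i=1}^n\Phi(X_i^T\beta)^{Y_i}\,(1-\Phi(X_i^T\beta))^{1-Y_i}\Big\}\exp\!\Big\{-\tfrac12(\beta-v)^TQ(\beta-v)\Big\}$$ be the posterior density on $\mathbb R^p$ of the Bayesian probit model with prior $\mathrm N_p(v,Q^{-1})$, and put $\Sigma=X^TX+Q$. Consider the Albert and Chib data augmentation chain on $\mathbb R^p$: from the state $\beta$, draw independently $Z_i\sim\mathrm N(X_i^T\beta,1)$ truncated to $(0,\infty)$ if $Y_i=1$ and to $(-\infty,0)$ if $Y_i=0$, and then draw the new state from $\mathrm N_p(\Sigma^{-1}(X^TZ+Qv),\Sigma^{-1})$. Let $k^{(m)}(\beta,\beta')$ be its $m$-step transition density, $m\ge1$, and let $\varphi(\beta)=\mathbb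 E(Z\mid\beta)\in\mathbb R^n$ be the mean of $Z=(Z_1,\dots,Z_n)^T$ in the first step. Put $\lambda=\lambda_{\max}^2(X\Sigma^{-1}X^T)$ and $L=n(1+\lambda)$, where $\lambda_{\max}$ is the largest eigenvalue (the square of $\lambda_{\max}$ is $0$ if $n=0$). Then the posterior density has a unique mode $\hat B$, $\lambda<1$, and $$\varphi_i(\beta)=X_i^T\beta+\frac{\phi(X_i^T\beta)}{\Phi(X_i^T\beta)}1_{\{1\}}(Y_i)-\frac{\phi(X_i^T\beta)}{1-\Phi(X_i^T\beta)}1_{\{0\}}(Y_i),\qquad 1\le i\le n.$$ Moreover, for every $d>2L/(1-\lambda)$ and every $r\in(0,1)$, setting $\varepsilon=2^{-n/2}e^{-d}$ and $$\hat\rho=\max\left\{(1-\varepsilon)^r,\ \Big(\frac{1+2L+\lambda d}{1+d}\Big)^{1-r}\big\{1+2(\lambda d+L)\big\}^r\right\},$$ we have for all $m\ge1$ and all $\beta\in\mathbb R^p$ $$\int_{\mathbb R^p}\big|k^{(m)}(\beta,\beta')-\pi(\beta')\big|\,d\beta'\;\le\;H(\beta)\,\hat\rho^{\,m-1},$$ where,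 with $\|\cdot\|$ the Euclidean norm, $$H(\beta)=2+\frac{L}{1-\lambda}+\operatorname{tr}(X\Sigma^{-1}X^T)+\Big\|(X\Sigma^{-1}X^T)^{-1/2}X\big\{\Sigma^{-1}(X^T\varphi(\beta)+Qv)-\hat B\big\}\Big\|^2 .$$ -/

import Mathlib

open MeasureTheory ProbabilityTheory Matrix

noncomputable section

namespace Probit

/-- Density `φ` of the standard normal distribution. -/
def stdPdf (t : ℝ) : ℝ := gaussianPDFReal 0 1 t

/-- Distribution function `Φ` of the standard normal distribution. -/
def stdCdf (t : ℝ) : ℝ := cdf (gaussianReal 0 1) t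

/-- Squared Euclidean norm of a real vector. -/
def sqNorm {k : ℕ} (u : Fin k → ℝ) : ℝ := ‖WithLp.toLp 2 u‖ ^ 2

/-- Largest eigenvalue of a real symmetric matrix. -/
def lambdaMax {k : ℕ} (M : Matrix (Fin k) (Fin k) ℝ) : ℝ := sSup (spectrum ℝ M)

open scoped MatrixOrder in
/-- `M ^ (-1/2)` for a positive definite real matrix `M`: the inverse of the unique positive
semidefinite square root. -/
def invSqrt {k : ℕ} (M : Matrix (Fin k) (Fin k) ℝ) : Matrix (Fin k) (Fin k) ℝ :=
  (CFC.sqrt M)⁻¹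

/-- Lebesgue density of the `k`-dimensional normal distribution with mean `μ` and
(positive definite) covariance matrix `C`. -/
def mvNormalPdf {k : ℕ} (μ : Fin k → ℝ) (C : Matrix (Fin k) (Fin k) ℝ) (x : Fin k → ℝ) : ℝ :=
  (Real.sqrt ((2 * Real.pi) ^ k * C.det))⁻¹ *
    Real.exp (-(1 / 2) * ((x - μ) ⬝ᵥ (C⁻¹ *ᵥ (x - μ))))

/-- The half line to which the latent variable of a response is truncated:
`(0, ∞)` for a success (`true`, i.e. `1`), `(-∞, 0)` for a failure (`false`, i.e. `0`). -/
def halfLine (y : Bool) : Set ℝ := if y then Set.Ioi 0 else Set.Iio 0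

/-- Lebesgue density of `TN(θ, 1; y)`, the `N(θ, 1)` distribution truncated to `halfLine y`. -/
def tnPdf (θ : ℝ) (y : Bool) (t : ℝ) : ℝ :=
  (halfLine y).indicator
    (fun s => gaussianPDFReal θ 1 s / (gaussianReal θ 1).real (halfLine y)) t

section Model

variable {n p : ℕ} (X : Matrix (Fin n) (Fin p) ℝ) (Y : Fin n → Bool)
  (Q : Matrix (Fin p) (Fin p) ℝ) (v : Fin p → ℝ)

/-- The prior density `ω`, up to normalization. -/
def prior (β : Fin p → ℝ) : ℝ :=
  Real.exp (-(1 / 2) * ((β - v) ⬝ᵥ (Q *ᵥ (β - v))))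

/-- The probit likelihood; the `i`-th row of `X` is the covariate vector `X_i`. -/
def likelihood (β : Fin p → ℝ) : ℝ :=
  ∏ i, if Y i then stdCdf (X i ⬝ᵥ β) else 1 - stdCdf (X i ⬝ᵥ β)

/-- The posterior density `π_{B|Y,X}`. -/
def posterior (β : Fin p → ℝ) : ℝ :=
  likelihood X Y β * prior Q v β / ∫ b, likelihood X Y b * prior Q v b

/-- `b` is a global maximizer of the posterior density. -/
def IsPosteriorMode (b : Fin p → ℝ) : Prop :=
  ∀ β, posterior X Y Q v β ≤ posterior X Y Q v b

/-- `Σ = XᵀX + Q`. -/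
def Sig : Matrix (Fin p) (Fin p) ℝ := Xᵀ * X + Q

/-- `π_{Z|B,Y,X}(z | β)`: independent coordinates `Z_i ~ TN(X_iᵀβ, 1; Y_i)`. -/
def latentPdf (z : Fin n → ℝ) (β : Fin p → ℝ) : ℝ :=
  ∏ i, tnPdf (X i ⬝ᵥ β) (Y i) (z i)

/-- `Σ⁻¹ (Xᵀ z + Q v)`, the conditional mean of `B` given `Z = z`. -/
def condMean (z : Fin n → ℝ) : Fin p → ℝ :=
  (Sig X Q)⁻¹ *ᵥ (Xᵀ *ᵥ z + Q *ᵥ v)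

/-- `π_{B|Z,Y,X}(β | z)`, the density of `N(Σ⁻¹ (Xᵀ z + Q v), Σ⁻¹)`. -/
def condPdf (β : Fin p → ℝ) (z : Fin n → ℝ) : ℝ :=
  mvNormalPdf (condMean X Q v z) (Sig X Q)⁻¹ β

/-- The Markov transition density of the Albert and Chib chain. -/
def kAC (β β' : Fin p → ℝ) : ℝ :=
  ∫ z : Fin n → ℝ, condPdf X Q v β' z * latentPdf X Y z β

/-- The `m`-step transition density of the Albert and Chib chain, for `m ≥ 1`
(the value at `m = 0`, where there is no density, is a placeholder). -/
def kACStep : ℕ → (Fin p → ℝ) → (Fin p → ℝ) → ℝ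
  | 0, _, _ => 0
  | 1, β, β' => kAC X Y Q v β β'
  | m + 2, β, β' => ∫ b : Fin p → ℝ, kACStep (m + 1) β b * kAC X Y Q v b β'

/-- `φ(β) = E(Z | B = β, Y, X)`. -/
def latentMean (β : Fin p → ℝ) (i : Fin n) : ℝ :=
  ∫ z : Fin n → ℝ, z i * latentPdf X Y z β

/-- `X Σ⁻¹ Xᵀ`. -/
def S : Matrix (Fin n) (Fin n) ℝ := X * (Sig X Q)⁻¹ * Xᵀ

/-- The drift rate `λ = λ_max² (X Σ⁻¹ Xᵀ)`. -/
def lam : ℝ := lambdaMax (S X Q) ^ 2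

/-- The drift constant `L = n (1 + λ)`. -/
def L : ℝ := (n : ℝ) * (1 + lam X Q)

/-- `H(β)`, where `Bhat` is the posterior mode. -/
def H (Bhat β : Fin p → ℝ) : ℝ :=
  2 + L X Q / (1 - lam X Q) + (S X Q).trace +
    sqNorm (invSqrt (S X Q) *ᵥ (X *ᵥ (condMean X Q v (latentMean X Y β) - Bhat)))

end Model

/-- The minorization number `ε = 2^(-n/2) e^(-d)`. -/
def eps (n : ℕ) (d : ℝ) : ℝ := (2 : ℝ) ^ (-(n : ℝ) / 2) * Real.exp (-d)

/-- The rate bound obtained from drift constants `lam`, `L`, minorization number `ε`,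
small-set level `d` and free parameter `r`. -/
def rhoHat (lam L ε d r : ℝ) : ℝ :=
  max ((1 - ε) ^ r)
    (((1 + 2 * L + lam * d) / (1 + d)) ^ (1 - r) * (1 + 2 * (lam * d + L)) ^ r)

end Probit

end

/-! The latent vector by itself is a Markov chain: draw the coefficients given `z`, then a new
latent vector (`latentChain`). An `m`-step transition of the Albert and Chib chain consists of one
latent draw, `m - 1` steps of `latentChain` and a final coefficient draw. It therefore suffices to
control the latent chain, and this is where the exponent `m - 1` comes from.

Drift. Write `S` for `X Σ⁻¹ Xᵀ` and let `V z` be the `S⁻¹`-quadratic form of `X (condMean z - b)`,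
where `b` is the posterior mode. The mean of a truncated normal is `1`-Lipschitz in its location,
because its derivative is the variance, which lies in `[0, 1]`. The mode is a fixed point of the
composed conditional means (`IsPosteriorMode.condMean_tnMean`). Hence the means contract by
`λ_max(S)²` (`dist2_S_mulVec_le`). The variances contribute at most `tr S ≤ n` in the latent draw
and exactly `n` in the coefficient draw, so one step sends `V` to at most `λ V + n (1 + λ)`.

Minorization. The latent draw sees the coefficients only through `X β`, so the centre of the
coefficient draw may be moved along the kernel of `X`. With the centre `nearest`, a parallelogram
inequality bounds the normal density below by `2^(-n/2) e^(-d)` times a fixed normal density of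
precision `Σ + Xᵀ S⁻¹ X`, whose determinant is `2 ^ n det Σ`. This holds whenever `V z ≤ d`.

Rate. The oscillation of a function is measured against `(1 + V x + V y) ^ s`. If both points lie in
`{V ≤ d}`, the common component cancels and the factor is `(1 - ε) ^ (1 - s) * A ^ s` with `A = 1 +
2 (λ d + L)`; otherwise drift alone gives `γ ^ s` with `γ = (1 + 2 L + λ d) / (1 + d)`
(`avg_sub_avg_le`). The `s` that equates the two factors makes them a weighted geometric mean of the
two entries of `rhoHat`, for every `r` (`exists_rate_exponent`).

The law after the first latent draw is then compared with the stationary latent law, using that the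
stationary mean of `V` is at most `L / (1 - λ)`. Testing against the sign of the difference of
densities gives the `L¹` bound. -/

namespace Probit

/-! ### Contraction of Markov chains under drift and minorization -/

/-- The bound on `f x - f y` by an affine function of `V x + V y` integrates against two measures
of equal mass. -/
theorem integral_sub_integral_le_of_affine {α : Type*} [MeasurableSpace α] {μ₁ μ₂ : Measure α}
    [IsFiniteMeasure μ₁] [IsFiniteMeasure μ₂] {q a b : ℝ} {f V : α → ℝ} (hq : 0 < q)
    (h₁ : μ₁.real Set.univ = q) (h₂ : μ₂.real Set.univ = q)
    (hf₁ : Integrable f μ₁) (hf₂ : Integrable f μ₂) (hV₁ : Integrable V μ₁) (hV₂ : Integrable V μ₂)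
    (hab : ∀ x y, f x - f y ≤ a + b * (V x + V y)) :
    ∫ x, f x ∂μ₁ - ∫ x, f x ∂μ₂ ≤ a * q + b * (∫ x, V x ∂μ₁ + ∫ x, V x ∂μ₂) := by
  -- The bound is in effect integrated against the product measure and divided by `q`: first in `x`
  -- with `y` fixed, then in `y`.
  have key : ∀ y, ∫ x, f x ∂μ₁ - b * ∫ x, V x ∂μ₁ ≤ q * (a + f y + b * V y) := by
    intro y
    have := integral_mono (hf₁.sub (hV₁.const_mul b)) (integrable_const (a + f y + b * V y))
      (fun x => by have := hab x y; simp only [Pi.sub_apply]; linarith)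
    rw [integral_sub' hf₁ (hV₁.const_mul b), integral_const_mul, integral_const, h₁] at this
    simpa using this
  have := integral_mono (integrable_const (μ := μ₂) (∫ x, f x ∂μ₁ - b * ∫ x, V x ∂μ₁))
    ((((integrable_const a).add hf₂).add (hV₂.const_mul b)).const_mul q) key
  rw [integral_const, h₂, integral_const_mul, integral_add' ((integrable_const a).add hf₂)
    (hV₂.const_mul b), integral_add' (integrable_const a) hf₂, integral_const_mul, integral_const,
    h₂] at this
  simp only [smul_eq_mul] at this
  have := le_of_mul_le_mul_left this hq
  linarith

/-- Concavity of `h ↦ h ^ s`: its graph lies below the tangent at `t`. This replaces Jensen's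
inequality and keeps all integrands affine in `V`. -/
theorem rpow_le_tangent {h t s : ℝ} (hh : 0 ≤ h) (ht : 0 < t) (hs0 : 0 ≤ s) (hs1 : s ≤ 1) :
    h ^ s ≤ t ^ s * ((1 - s) + s * (h / t)) := by
  have h1 : (1 + (h / t - 1)) ^ s ≤ 1 + s * (h / t - 1) :=
    rpow_one_add_le_one_add_mul_self
      (by have := div_nonneg hh ht.le; linarith) hs0 hs1
  have h2 : h ^ s = t ^ s * (1 + (h / t - 1)) ^ s := by
    rw [← Real.mul_rpow ht.le (by have := div_nonneg hh ht.le; linarith)]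
    congr 1; field_simp; ring
  rw [h2]
  exact mul_le_mul_of_nonneg_left (by linarith) (Real.rpow_nonneg ht.le s)

/-- Jensen's inequality for the product coupling of two measures of mass `q`: `t` bounds the
normalized mean of `1 + V x + V y`, so the tangent at `t` can be integrated. -/
theorem integral_sub_integral_le_of_rpow {α : Type*} [MeasurableSpace α] {μ₁ μ₂ : Measure α}
    [IsFiniteMeasure μ₁] [IsFiniteMeasure μ₂] {q c s t : ℝ} {f V : α → ℝ} (hq : 0 < q)
    (hc : 0 ≤ c) (hs0 : 0 ≤ s) (hs1 : s ≤ 1) (ht : 0 < t) (hV0 : ∀ x, 0 ≤ V x)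
    (h₁ : μ₁.real Set.univ = q) (h₂ : μ₂.real Set.univ = q)
    (hf₁ : Integrable f μ₁) (hf₂ : Integrable f μ₂) (hV₁ : Integrable V μ₁) (hV₂ : Integrable V μ₂)
    (hf : ∀ x y, f x - f y ≤ c * (1 + V x + V y) ^ s)
    (hqt : q + ∫ x, V x ∂μ₁ + ∫ x, V x ∂μ₂ ≤ q * t) :
    ∫ x, f x ∂μ₁ - ∫ x, f x ∂μ₂ ≤ q * (c * t ^ s) := by
  have hts := Real.rpow_pos_of_pos ht s
  have := integral_sub_integral_le_of_affine (a := c * (t ^ s * ((1 - s) + s / t)))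
    (b := c * (t ^ s * (s / t))) hq h₁ h₂ hf₁ hf₂ hV₁ hV₂ (fun x y => by
      refine (hf x y).trans ?_
      have := mul_le_mul_of_nonneg_left (rpow_le_tangent (h := 1 + V x + V y) (t := t)
        (by have := hV0 x; have := hV0 y; linarith) ht hs0 hs1) hc
      refine this.trans (le_of_eq ?_)
      field_simp
      ring)
  refine this.trans ?_
  have e : c * (t ^ s * ((1 - s) + s / t)) * q +
      c * (t ^ s * (s / t)) * (∫ x, V x ∂μ₁ + ∫ x, V x ∂μ₂) =
      c * t ^ s * ((1 - s) * q + s / t * (q + ∫ x, V x ∂μ₁ + ∫ x, V x ∂μ₂)) := by ring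
  rw [e]
  have h3 : s / t * (q + ∫ x, V x ∂μ₁ + ∫ x, V x ∂μ₂) ≤ s / t * (q * t) :=
    mul_le_mul_of_nonneg_left hqt (by positivity)
  have h4 : s / t * (q * t) = s * q := by field_simp
  calc _ ≤ c * t ^ s * ((1 - s) * q + s * q) := by
        apply mul_le_mul_of_nonneg_left _ (by positivity); linarith
    _ = _ := by ring

/-- The averaging operator of a Markov kernel on functions. -/
noncomputable def avg {α β : Type*} [MeasurableSpace α] [MeasurableSpace β] (K : Kernel α β) (f : β → ℝ)
    (x : α) : ℝ := ∫ y, f y ∂K x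

theorem measurable_avg {α β : Type*} [MeasurableSpace α] [MeasurableSpace β] (K : Kernel α β)
    [IsSFiniteKernel K] {f : β → ℝ} (hf : Measurable f) : Measurable (avg K f) :=
  (hf.stronglyMeasurable.integral_kernel (κ := K)).measurable

theorem abs_avg_le_one {α β : Type*} [MeasurableSpace α] [MeasurableSpace β] (K : Kernel α β)
    [IsMarkovKernel K] {f : β → ℝ} (hf : ∀ y, |f y| ≤ 1) (x : α) : |avg K f x| ≤ 1 := by
  have := norm_integral_le_of_norm_le_const (μ := K x) (f := f) (C := 1)
    (Filter.Eventually.of_forall hf)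
  simpa [avg] using this

theorem integrable_of_abs_le_one {α : Type*} [MeasurableSpace α] {μ : Measure α}
    [IsFiniteMeasure μ] {f : α → ℝ} (hm : Measurable f) (hf : ∀ y, |f y| ≤ 1) : Integrable f μ :=
  Integrable.of_bound hm.aestronglyMeasurable 1 (Filter.Eventually.of_forall hf)

section Contraction

variable {α : Type*} [MeasurableSpace α] {K : Kernel α α} [IsMarkovKernel K] {V : α → ℝ}
  {lam L d ε s ρ : ℝ} {ν : Measure α} [IsProbabilityMeasure ν]

/-- One step of a chain with a drift and a minorization condition contracts the oscillation
bounds `c (1 + V x + V y) ^ s`. -/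
theorem avg_sub_avg_le (hV0 : ∀ x, 0 ≤ V x) (hVi : ∀ x, Integrable V (K x))
    (hdrift : ∀ x, ∫ y, V y ∂K x ≤ lam * V x + L)
    (hmin : ∀ x, V x ≤ d → ENNReal.ofReal ε • ν ≤ K x)
    (hlam0 : 0 ≤ lam) (hlam1 : lam < 1) (hL : 0 ≤ L) (hd : 0 ≤ d) (hε0 : 0 < ε) (hε1 : ε < 1)
    (hs0 : 0 ≤ s) (hs1 : s ≤ 1)
    (hρ₁ : ((1 + 2 * L + lam * d) / (1 + d)) ^ s ≤ ρ)
    (hρ₂ : (1 - ε) ^ (1 - s) * (1 + 2 * (lam * d + L)) ^ s ≤ ρ)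
    {f : α → ℝ} (hfm : Measurable f) (hf1 : ∀ x, |f x| ≤ 1) {c : ℝ} (hc : 0 ≤ c)
    (hf : ∀ x y, f x - f y ≤ c * (1 + V x + V y) ^ s) (x y : α) :
    avg K f x - avg K f y ≤ ρ * c * (1 + V x + V y) ^ s := by
  have hx := hV0 x
  have hy := hV0 y
  -- Minorization applies only if both points are in the small set. Otherwise `V x + V y ≥ d`, and
  -- drift alone contracts.
  by_cases hC : V x ≤ d ∧ V y ≤ d
  · obtain ⟨hxd, hyd⟩ := hC
    have res : ∀ w, V w ≤ d → ∃ η : Measure α, IsFiniteMeasure η ∧ η.real Set.univ = 1 - ε ∧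
        Integrable V η ∧ (∫ u, V u ∂η ≤ lam * V w + L) ∧
        avg K f w = ∫ u, f u ∂η + ε * ∫ u, f u ∂ν := by
      intro w hw
      have hle := hmin w hw
      have hfin : IsFiniteMeasure (ENNReal.ofReal ε • ν) := by
        constructor; simp
      have hdec : K w = (K w - ENNReal.ofReal ε • ν) + ENNReal.ofReal ε • ν :=
        (Measure.sub_add_cancel_of_le hle).symm
      set η := K w - ENNReal.ofReal ε • ν with hη
      have hηle : η ≤ K w := Measure.sub_le
      have hηfin : IsFiniteMeasure η := isFiniteMeasure_of_le _ hηle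
      refine ⟨η, hηfin, ?_, (hVi w).mono_measure hηle, ?_, ?_⟩
      · have h1 : (K w).real Set.univ = (η + ENNReal.ofReal ε • ν).real Set.univ := by rw [← hdec]
        rw [measureReal_add_apply, measureReal_ennreal_smul_apply, probReal_univ (μ := K w), probReal_univ (μ := ν),
          ENNReal.toReal_ofReal hε0.le] at h1
        linarith
      · exact (integral_mono_measure hηle (Filter.Eventually.of_forall hV0) (hVi w)).trans
          (hdrift w)
      · rw [avg, hdec, integral_add_measure (integrable_of_abs_le_one hfm hf1)
          (integrable_of_abs_le_one hfm hf1), integral_smul_measure,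
          ENNReal.toReal_ofReal hε0.le, smul_eq_mul]
    obtain ⟨η₁, _, hη₁, hVη₁, hVη₁', e₁⟩ := res x hxd
    obtain ⟨η₂, _, hη₂, hVη₂, hVη₂', e₂⟩ := res y hyd
    have hq : 0 < 1 - ε := by linarith
    have hA : 0 < 1 + 2 * (lam * d + L) := by positivity
    have hlx := mul_le_mul_of_nonneg_left hxd hlam0
    have hly := mul_le_mul_of_nonneg_left hyd hlam0
    -- The `ν`-parts cancel, leaving residuals of mass `1 - ε`. Their `V`-integrals are still at
    -- most `lam * d + L` each, since `V ≥ 0`; dividing by the mass gives `t`.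
    have := integral_sub_integral_le_of_rpow (t := (1 + 2 * (lam * d + L)) / (1 - ε)) hq hc hs0 hs1
      (by positivity) hV0 hη₁ hη₂ (integrable_of_abs_le_one hfm hf1)
      (integrable_of_abs_le_one hfm hf1) hVη₁ hVη₂ hf (by
        rw [mul_div_cancel₀ _ hq.ne']; linarith)
    have e3 : (1 - ε) * (c * ((1 + 2 * (lam * d + L)) / (1 - ε)) ^ s) =
        c * ((1 - ε) ^ (1 - s) * (1 + 2 * (lam * d + L)) ^ s) := by
      rw [Real.div_rpow hA.le hq.le, Real.rpow_sub hq, Real.rpow_one]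
      ring
    rw [e3] at this
    have hh : 1 ≤ (1 + V x + V y) ^ s := Real.one_le_rpow (by linarith) hs0
    have hρ0 : 0 ≤ ρ := le_trans (by positivity) hρ₂
    calc avg K f x - avg K f y ≤ c * ((1 - ε) ^ (1 - s) * (1 + 2 * (lam * d + L)) ^ s) := by
          rw [e₁, e₂]; linarith
      _ ≤ c * ρ := mul_le_mul_of_nonneg_left hρ₂ hc
      _ ≤ c * ρ * (1 + V x + V y) ^ s := le_mul_of_one_le_right (by positivity) hh
      _ = _ := by ring
  · have hsum : d ≤ V x + V y := by
      by_contra hcon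
      exact hC ⟨by linarith, by linarith⟩
    have hγ : 0 ≤ (1 + 2 * L + lam * d) / (1 + d) := by positivity
    -- The ratio `(1 + 2 L + lam u) / (1 + u)` decreases in `u`, so on `u ≥ d` it is largest at `u =
    -- d`.
    have ht : 1 + 2 * L + lam * (V x + V y) ≤
        (1 + 2 * L + lam * d) / (1 + d) * (1 + V x + V y) := by
      rw [div_mul_eq_mul_div, le_div_iff₀ (by linarith)]
      nlinarith [mul_nonneg (sub_nonneg.2 hsum) (by linarith : (0 : ℝ) ≤ 1 - lam + 2 * L)]
    have hx' := hdrift x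
    have hy' := hdrift y
    have := integral_sub_integral_le_of_rpow (μ₁ := K x) (μ₂ := K y)
      (t := 1 + 2 * L + lam * (V x + V y)) one_pos hc hs0 hs1
      (by positivity) hV0 probReal_univ probReal_univ (integrable_of_abs_le_one hfm hf1)
      (integrable_of_abs_le_one hfm hf1) (hVi x) (hVi y) hf (by linarith)
    rw [one_mul] at this
    calc avg K f x - avg K f y ≤ c * (1 + 2 * L + lam * (V x + V y)) ^ s := this
      _ ≤ c * ((1 + 2 * L + lam * d) / (1 + d) * (1 + V x + V y)) ^ s := by
          gcongr
      _ = c * (((1 + 2 * L + lam * d) / (1 + d)) ^ s * (1 + V x + V y) ^ s) := by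
          rw [Real.mul_rpow hγ (by linarith)]
      _ ≤ c * (ρ * (1 + V x + V y) ^ s) := by gcongr
      _ = _ := by ring

/-- The induction starts with constant `2`, the oscillation of a function bounded by `1`. The
condition `s ≤ 1 / 2` makes the final bound `2 + V x + V y`, with coefficient one on `V`, because `2
√(1 + u) ≤ 2 + u`. -/
theorem avg_iterate_sub_le (hV0 : ∀ x, 0 ≤ V x) (hVi : ∀ x, Integrable V (K x))
    (hdrift : ∀ x, ∫ y, V y ∂K x ≤ lam * V x + L)
    (hmin : ∀ x, V x ≤ d → ENNReal.ofReal ε • ν ≤ K x)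
    (hlam0 : 0 ≤ lam) (hlam1 : lam < 1) (hL : 0 ≤ L) (hd : 0 ≤ d) (hε0 : 0 < ε) (hε1 : ε < 1)
    (hs0 : 0 ≤ s) (hs1 : s ≤ 1 / 2)
    (hρ₁ : ((1 + 2 * L + lam * d) / (1 + d)) ^ s ≤ ρ)
    (hρ₂ : (1 - ε) ^ (1 - s) * (1 + 2 * (lam * d + L)) ^ s ≤ ρ)
    {f : α → ℝ} (hfm : Measurable f) (hf1 : ∀ x, |f x| ≤ 1) (m : ℕ) (x y : α) :
    (avg K)^[m] f x - (avg K)^[m] f y ≤ ρ ^ m * (2 + V x + V y) := by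
  have hρ0 : 0 ≤ ρ := le_trans (by positivity) hρ₁
  have hone : ∀ x y, 1 ≤ 1 + V x + V y := fun x y => by
    have := hV0 x; have := hV0 y; linarith
  have key : ∀ m : ℕ, Measurable ((avg K)^[m] f) ∧ (∀ x, |(avg K)^[m] f x| ≤ 1) ∧
      ∀ x y, (avg K)^[m] f x - (avg K)^[m] f y ≤ (ρ ^ m * 2) * (1 + V x + V y) ^ s := by
    intro m
    induction m with
    | zero =>
      refine ⟨hfm, hf1, fun x y => ?_⟩
      have h1 := abs_le.1 (hf1 x)
      have h2 := abs_le.1 (hf1 y)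
      have := Real.one_le_rpow (hone x y) hs0
      simp only [Function.iterate_zero, id, pow_zero]
      linarith
    | succ m ih =>
      obtain ⟨h1, h2, h3⟩ := ih
      rw [Function.iterate_succ_apply']
      refine ⟨measurable_avg K h1, abs_avg_le_one K h2, fun x y => ?_⟩
      have := avg_sub_avg_le hV0 hVi hdrift hmin hlam0 hlam1 hL hd hε0 hε1 hs0 (by linarith)
        hρ₁ hρ₂ h1 h2 (by positivity) h3 x y
      rw [pow_succ']
      linarith
  refine ((key m).2.2 x y).trans ?_
  rw [mul_assoc]
  refine mul_le_mul_of_nonneg_left ?_ (pow_nonneg hρ0 m)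
  have h1 : (1 + V x + V y) ^ s ≤ (1 + V x + V y) ^ (1 / 2 : ℝ) :=
    Real.rpow_le_rpow_of_exponent_le (hone x y) hs1
  have h2 := rpow_le_tangent (h := 1 + V x + V y) (t := 1) (s := 1 / 2)
    (by linarith [hone x y]) one_pos (by norm_num) (by norm_num)
  rw [Real.one_rpow] at h2
  linarith

end Contraction

/-- The exponent that balances the two contraction factors. -/
theorem exists_rate_exponent {γ A q r : ℝ} (hγ0 : 0 < γ) (hγ1 : γ < 1) (hA : 1 < A)
    (hq0 : 0 < q) (hq1 : q < 1) (hle : 1 ≤ q * (A / γ)) :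
    ∃ s : ℝ, 0 ≤ s ∧ s ≤ 1 / 2 ∧ γ ^ s ≤ max (q ^ r) (γ ^ (1 - r) * A ^ r) ∧
      q ^ (1 - s) * A ^ s ≤ max (q ^ r) (γ ^ (1 - r) * A ^ r) := by
  have hA0 : 0 < A := by linarith
  have ha : Real.log γ < 0 := Real.log_neg hγ0 hγ1
  have hb : 0 < Real.log A := Real.log_pos hA
  have he : Real.log q < 0 := Real.log_neg hq0 hq1
  have hl : 0 ≤ Real.log q + (Real.log A - Real.log γ) := by
    rw [← Real.log_div hA0.ne' hγ0.ne', ← Real.log_mul hq0.ne' (by positivity)]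
    exact Real.log_nonneg hle
  have eq1 : ∀ t : ℝ, γ ^ t = Real.exp (t * Real.log γ) := fun t => by
    rw [Real.rpow_def_of_pos hγ0, mul_comm]
  have eq2 : ∀ t : ℝ, A ^ t = Real.exp (t * Real.log A) := fun t => by
    rw [Real.rpow_def_of_pos hA0, mul_comm]
  have eq3 : ∀ t : ℝ, q ^ t = Real.exp (t * Real.log q) := fun t => by
    rw [Real.rpow_def_of_pos hq0, mul_comm]
  simp only [eq1, eq2, eq3, ← Real.exp_add]
  clear eq1 eq2 eq3
  obtain ⟨a, haeq⟩ : ∃ a, Real.log γ = -a := ⟨-Real.log γ, by ring⟩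
  obtain ⟨b, hbeq⟩ : ∃ b, Real.log A = b := ⟨_, rfl⟩
  obtain ⟨e, heeq⟩ : ∃ e, Real.log q = -e := ⟨-Real.log q, by ring⟩
  rw [haeq] at ha hl ⊢
  rw [hbeq] at hb hl ⊢
  rw [heeq] at he hl ⊢
  have hpos : 0 < a + b + e := by linarith
  have hs : ∀ {z : ℝ}, z = -(e * a / (a + b + e)) →
      Real.exp z ≤ max (Real.exp (r * -e)) (Real.exp ((1 - r) * -a + r * b)) := by
    intro z hz
    by_contra hcon
    rw [not_le, max_lt_iff, Real.exp_lt_exp, Real.exp_lt_exp, hz] at hcon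
    obtain ⟨h1, h2⟩ := hcon
    have h1' : e * a < r * e * (a + b + e) := by
      rw [← div_lt_iff₀ hpos]; linarith
    have h2' : e * a < ((1 - r) * a - r * b) * (a + b + e) := by
      rw [← div_lt_iff₀ hpos]; linarith
    -- With weights `a + b` and `e`, the two exponents on the right average to `-(e * a / (a + b +
    -- e))`, whatever `r` is; they cannot both lie below it.
    nlinarith [mul_lt_mul_of_pos_left h1' (by linarith : 0 < a + b),
      mul_lt_mul_of_pos_left h2' (by linarith : 0 < e)]
  -- This `s` solves `γ ^ s = q ^ (1 - s) * A ^ s`. The hypothesis `hle` says `e ≤ a + b`, that is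
  -- `s ≤ 1 / 2`.
  refine ⟨e / (a + b + e), by apply div_nonneg <;> linarith, ?_, hs ?_, hs ?_⟩
  · rw [div_le_div_iff₀ hpos two_pos]; linarith
  · field_simp
  · field_simp; ring

end Probit

/-! ### Product measures and means of quadratic forms -/

noncomputable section

namespace Probit

/-- A product of measures with densities has the product density. -/
theorem pi_withDensity_ofReal {ι : Type*} [Fintype ι] {f : ι → ℝ → ℝ} (hf0 : ∀ i x, 0 ≤ f i x)
    (hfi : ∀ i, Integrable (f i)) :
    Measure.pi (fun i => (volume : Measure ℝ).withDensity fun x => ENNReal.ofReal (f i x)) =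
      (volume : Measure (ι → ℝ)).withDensity fun x => ENNReal.ofReal (∏ i, f i (x i)) := by
  have hfin : ∀ i, IsFiniteMeasure
      ((volume : Measure ℝ).withDensity fun x => ENNReal.ofReal (f i x)) :=
    fun i => isFiniteMeasure_withDensity_ofReal (hfi i).2
  refine Measure.pi_eq fun s hs => ?_
  rw [withDensity_apply _ (MeasurableSet.univ_pi hs), volume_pi, Measure.restrict_pi_pi,
    ← ofReal_integral_eq_lintegral_ofReal (Integrable.fintype_prod fun i => (hfi i).restrict)
      (Filter.Eventually.of_forall fun x => Finset.prod_nonneg fun i _ => hf0 i _),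
    integral_fintype_prod_eq_prod, ENNReal.ofReal_prod_of_nonneg
      (fun i _ => integral_nonneg fun x => hf0 i x)]
  refine Finset.prod_congr rfl fun i _ => ?_
  rw [withDensity_apply _ (hs i), ← ofReal_integral_eq_lintegral_ofReal (hfi i).restrict
    (Filter.Eventually.of_forall fun x => hf0 i x)]

section Moments

variable {k : ℕ} {ν : Fin k → Measure ℝ} [∀ i, IsProbabilityMeasure (ν i)]

theorem integrable_pi_mul (hν : ∀ i, MemLp id 2 (ν i)) (c : Fin k → ℝ) (i j : Fin k) :
    Integrable (fun z => (z i - c i) * (z j - c j)) (Measure.pi ν) := by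
  have h : ∀ i, MemLp (fun z : Fin k → ℝ => z i - c i) 2 (Measure.pi ν) := fun i =>
    ((hν i).comp_measurePreserving (measurePreserving_eval ν i)).sub (memLp_const (c i))
  exact (h i).integrable_mul (h j)

theorem integral_pi_mul (hν : ∀ i, MemLp id 2 (ν i)) (c : Fin k → ℝ) (i j : Fin k) :
    ∫ z, (z i - c i) * (z j - c j) ∂Measure.pi ν =
      (∫ x, x ∂ν i - c i) * (∫ x, x ∂ν j - c j) + if i = j then Var[id; ν i] else 0 := by
  have hint : ∀ i, Integrable (fun x : ℝ => x) (ν i) := fun i => (hν i).integrable (by norm_num)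
  have h1 : ∀ i, ∫ z, (z i - c i) ∂Measure.pi ν = ∫ x, x ∂ν i - c i := by
    intro i
    rw [integral_comp_eval (μ := ν) (i := i) (f := fun x => x - c i) (by fun_prop),
      integral_sub (hint i) (integrable_const _)]
    simp
  by_cases hij : i = j
  · subst hij
    rw [if_pos rfl, integral_comp_eval (μ := ν) (i := i) (f := fun x => (x - c i) * (x - c i)) (by fun_prop)]
    have hsub : MemLp (fun x => id x - c i) 2 (ν i) := (hν i).sub (memLp_const (c i))
    have := variance_eq_sub hsub
    rw [variance_sub_const (hν i).aestronglyMeasurable] at this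
    have e : ∫ x, (id x - c i) ∂ν i = ∫ x, x ∂ν i - c i := by
      simp only [id]
      rw [integral_sub (hint i) (integrable_const _)]; simp
    rw [e] at this
    rw [this]
    simp only [Pi.pow_apply, id]
    simp only [sq]
    ring
  · rw [if_neg hij, add_zero, ← h1 i, ← h1 j]
    have hind : iIndepFun (fun i (z : Fin k → ℝ) => z i - c i) (Measure.pi ν) :=
      iIndepFun_pi (X := fun i x => x - c i) (fun i => by fun_prop)
    exact (hind.indepFun hij).integral_fun_mul_eq_mul_integral
      (by fun_prop : Measurable fun z : Fin k → ℝ => z i - c i).aestronglyMeasurable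
      (by fun_prop : Measurable fun z : Fin k → ℝ => z j - c j).aestronglyMeasurable

theorem dotProduct_mulVec_eq_sum (A : Matrix (Fin k) (Fin k) ℝ) (u : Fin k → ℝ) :
    u ⬝ᵥ (A *ᵥ u) = ∑ i, ∑ j, A i j * (u i * u j) := by
  simp only [dotProduct, mulVec, Finset.mul_sum]
  exact Finset.sum_congr rfl fun i _ => Finset.sum_congr rfl fun j _ => by ring

theorem integrable_pi_quadratic (hν : ∀ i, MemLp id 2 (ν i)) (A : Matrix (Fin k) (Fin k) ℝ)
    (c : Fin k → ℝ) : Integrable (fun z => (z - c) ⬝ᵥ (A *ᵥ (z - c))) (Measure.pi ν) := by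
  simp only [dotProduct_mulVec_eq_sum, Pi.sub_apply]
  exact integrable_finsetSum _ fun i _ => integrable_finsetSum _ fun j _ =>
    (integrable_pi_mul hν c i j).const_mul _

/-- The mean of a quadratic form in independent variables. -/
theorem integral_pi_quadratic (hν : ∀ i, MemLp id 2 (ν i)) (A : Matrix (Fin k) (Fin k) ℝ)
    (c : Fin k → ℝ) :
    ∫ z, (z - c) ⬝ᵥ (A *ᵥ (z - c)) ∂Measure.pi ν =
      ((fun i => ∫ x, x ∂ν i) - c) ⬝ᵥ (A *ᵥ ((fun i => ∫ x, x ∂ν i) - c)) +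
        ∑ i, A i i * Var[id; ν i] := by
  simp only [dotProduct_mulVec_eq_sum, Pi.sub_apply]
  have hint : ∀ i j, Integrable (fun z => A i j * ((z i - c i) * (z j - c j))) (Measure.pi ν) :=
    fun i j => (integrable_pi_mul hν c i j).const_mul _
  rw [integral_finsetSum _ fun i _ => integrable_finsetSum _ fun j _ => hint i j, ← Finset.sum_add_distrib]
  refine Finset.sum_congr rfl fun i _ => ?_
  rw [integral_finsetSum _ fun j _ => hint i j]
  simp only [integral_const_mul, integral_pi_mul hν, mul_add, Finset.sum_add_distrib]
  simp

end Moments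

/-! ### Multivariate normal distributions -/

section Gaussian

variable {k : ℕ} {C : Matrix (Fin k) (Fin k) ℝ}

open scoped MatrixOrder in
/-- The positive semidefinite square root of a matrix. -/
def psqrt (C : Matrix (Fin k) (Fin k) ℝ) : Matrix (Fin k) (Fin k) ℝ := CFC.sqrt C

open scoped MatrixOrder in
theorem psqrt_spec (hC : C.PosDef) :
    psqrt C * psqrt C = C ∧ (psqrt C)ᵀ = psqrt C ∧ 0 < (psqrt C).det := by
  have h1 : psqrt C * psqrt C = C := CFC.sqrt_mul_sqrt_self C hC.posSemidef.nonneg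
  have h2 : (psqrt C).PosSemidef := nonneg_iff_posSemidef.1 (CFC.sqrt_nonneg C)
  refine ⟨h1, by simpa using h2.isHermitian.eq, lt_of_le_of_ne h2.det_nonneg fun h => ?_⟩
  have h3 := congrArg det h1
  rw [det_mul, ← h] at h3
  have := hC.det_pos
  linarith

theorem mvNormalPdf_nonneg (μ : Fin k → ℝ) (C : Matrix (Fin k) (Fin k) ℝ) (x : Fin k → ℝ) :
    0 ≤ mvNormalPdf μ C x := by
  unfold mvNormalPdf; positivity

@[fun_prop]
theorem continuous_quadratic {q : ℕ} (A : Matrix (Fin q) (Fin q) ℝ) :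
    Continuous fun x : Fin q → ℝ => x ⬝ᵥ (A *ᵥ x) := by
  simp only [dotProduct_mulVec_eq_sum]; fun_prop

theorem continuous_mvNormalPdf (C : Matrix (Fin k) (Fin k) ℝ) :
    Continuous fun x : (Fin k → ℝ) × (Fin k → ℝ) => mvNormalPdf x.1 C x.2 := by
  unfold mvNormalPdf
  have : Continuous fun x : (Fin k → ℝ) × (Fin k → ℝ) => (x.2 - x.1) ⬝ᵥ (C⁻¹ *ᵥ (x.2 - x.1)) :=
    (continuous_quadratic C⁻¹).comp (continuous_snd.sub continuous_fst)
  fun_prop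

/-- The multivariate normal density at an affine image of a standard normal vector. -/
theorem mvNormalPdf_add_sqrt_mulVec (hC : C.PosDef) (μ w : Fin k → ℝ) :
    (psqrt C).det * mvNormalPdf μ C (μ + psqrt C *ᵥ w) =
      ∏ i, gaussianPDFReal 0 1 (w i) := by
  obtain ⟨h1, h2, h3⟩ := psqrt_spec hC
  set R := psqrt C
  have hR : IsUnit R.det := isUnit_iff_ne_zero.2 h3.ne'
  have e1 : R *ᵥ w ⬝ᵥ (C⁻¹ *ᵥ (R *ᵥ w)) = w ⬝ᵥ w := by
    rw [← h1, Matrix.mul_inv_rev, mulVec_mulVec, Matrix.mul_assoc, nonsing_inv_mul _ hR, Matrix.mul_one,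
      dotProduct_comm, dotProduct_mulVec, ← mulVec_transpose, mulVec_mulVec, h2,
      mul_nonsing_inv _ hR, one_mulVec]
  have e2 : Real.sqrt ((2 * Real.pi) ^ k * C.det) = Real.sqrt (2 * Real.pi) ^ k * R.det := by
    rw [← h1, det_mul, Real.sqrt_mul (by positivity), Real.sqrt_mul_self h3.le]
    congr 1
    rw [Real.sqrt_eq_iff_mul_self_eq (by positivity) (by positivity), ← mul_pow,
      Real.mul_self_sqrt (by positivity)]
  unfold mvNormalPdf
  rw [add_sub_cancel_left, e1, e2, mul_inv, ← mul_assoc, mul_comm _ (R.det)⁻¹, ← mul_assoc,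
    mul_inv_cancel₀ h3.ne', one_mul]
  simp only [gaussianPDFReal, NNReal.coe_one, mul_one, sub_zero, Finset.prod_mul_distrib,
    Finset.prod_const, Finset.card_univ, Fintype.card_fin, inv_pow]
  rw [← Real.exp_sum, ← Finset.sum_div, Finset.sum_neg_distrib]
  congr 2
  simp only [dotProduct, ← sq]
  ring

/-- The `N(μ, C)` distribution. -/
def mvNormal (μ : Fin k → ℝ) (C : Matrix (Fin k) (Fin k) ℝ) : Measure (Fin k → ℝ) :=
  volume.withDensity fun x => ENNReal.ofReal (mvNormalPdf μ C x)

/-- Change of variables with Jacobian `(psqrt C).det`. Total mass, moments and translates of normal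
laws then reduce to independent standard normal coordinates. -/
theorem mvNormal_eq_map (hC : C.PosDef) (μ : Fin k → ℝ) :
    mvNormal μ C =
      (Measure.pi fun _ : Fin k => gaussianReal 0 1).map fun w => μ + psqrt C *ᵥ w := by
  obtain ⟨h1, h2, h3⟩ := psqrt_spec hC
  have hpi : (Measure.pi fun _ : Fin k => gaussianReal 0 1) =
      volume.withDensity fun w : Fin k → ℝ => ENNReal.ofReal (∏ i, gaussianPDFReal 0 1 (w i)) := by
    rw [← pi_withDensity_ofReal (fun _ x => gaussianPDFReal_nonneg 0 1 x)
      (fun _ => integrable_gaussianPDFReal 0 1)]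
    simp only [gaussianReal_of_var_ne_zero (0 : ℝ) one_ne_zero]
    rfl
  have hg : Measurable fun w : Fin k → ℝ => μ + psqrt C *ᵥ w := by
    have : Continuous fun w : Fin k → ℝ => μ + psqrt C *ᵥ w := by fun_prop
    exact this.measurable
  have hmap : (volume : Measure (Fin k → ℝ)).map (fun w => μ + psqrt C *ᵥ w) =
      ENNReal.ofReal ((psqrt C).det)⁻¹ • volume := by
    have h := Real.map_matrix_volume_pi_eq_smul_volume_pi h3.ne'
    rw [abs_of_pos (inv_pos.2 h3)] at h
    have hc : (fun w : Fin k → ℝ => μ + psqrt C *ᵥ w) =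
      (fun w => μ + w) ∘ (Matrix.toLin' (psqrt C)) := by
        funext w; simp
    rw [hc, ← Measure.map_map (by fun_prop)
      (LinearMap.continuous_of_finiteDimensional _).measurable, h, Measure.map_smul,
      (measurePreserving_add_left volume μ).map_eq]
  have hpm : Measurable fun x => ENNReal.ofReal (mvNormalPdf μ C x) :=
    ((continuous_mvNormalPdf C).comp (Continuous.prodMk_right μ)).measurable.ennreal_ofReal
  ext s hs
  rw [Measure.map_apply hg hs, hpi, withDensity_apply _ (hg hs), mvNormal, withDensity_apply _ hs]
  simp only [← mvNormalPdf_add_sqrt_mulVec hC μ, ENNReal.ofReal_mul h3.le]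
  have hpm' : Measurable fun w => ENNReal.ofReal (mvNormalPdf μ C (μ + psqrt C *ᵥ w)) :=
    hpm.comp hg
  rw [lintegral_const_mul _ hpm', ← setLIntegral_map hs hpm hg, hmap,
    Measure.restrict_smul, lintegral_smul_measure, smul_eq_mul, ← mul_assoc,
    ← ENNReal.ofReal_mul h3.le, mul_inv_cancel₀ h3.ne', ENNReal.ofReal_one, one_mul]

theorem isProbabilityMeasure_mvNormal (hC : C.PosDef) (μ : Fin k → ℝ) :
    IsProbabilityMeasure (mvNormal μ C) := by
  rw [mvNormal_eq_map hC]
  exact Measure.isProbabilityMeasure_map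
    (by fun_prop : Continuous fun w : Fin k → ℝ => μ + psqrt C *ᵥ w).aemeasurable

theorem mvNormalPdf_quadratic_aux (hC : C.PosDef) (μ c : Fin k → ℝ)
    (A : Matrix (Fin k) (Fin k) ℝ) (w : Fin k → ℝ) :
    (μ + psqrt C *ᵥ w - c) ⬝ᵥ (A *ᵥ (μ + psqrt C *ᵥ w - c)) =
      (w - (psqrt C)⁻¹ *ᵥ (c - μ)) ⬝ᵥ ((psqrt C * A * psqrt C) *ᵥ
        (w - (psqrt C)⁻¹ *ᵥ (c - μ))) := by
  obtain ⟨h1, h2, h3⟩ := psqrt_spec hC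
  have hR : IsUnit (psqrt C).det := isUnit_iff_ne_zero.2 h3.ne'
  have e : μ + psqrt C *ᵥ w - c = psqrt C *ᵥ (w - (psqrt C)⁻¹ *ᵥ (c - μ)) := by
    rw [mulVec_sub, mulVec_mulVec, mul_nonsing_inv _ hR, one_mulVec]; abel
  rw [e]
  generalize w - (psqrt C)⁻¹ *ᵥ (c - μ) = u
  conv_rhs => rw [Matrix.mul_assoc, ← mulVec_mulVec, dotProduct_mulVec, ← mulVec_transpose, h2,
    ← mulVec_mulVec]

theorem integrable_mvNormal_quadratic (hC : C.PosDef) (μ c : Fin k → ℝ)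
    (A : Matrix (Fin k) (Fin k) ℝ) :
    Integrable (fun x => (x - c) ⬝ᵥ (A *ᵥ (x - c))) (mvNormal μ C) := by
  have hc : Continuous fun w : Fin k → ℝ => μ + psqrt C *ᵥ w := by fun_prop
  have hq : Continuous fun x : Fin k → ℝ => (x - c) ⬝ᵥ (A *ᵥ (x - c)) :=
    (continuous_quadratic A).comp (continuous_id.sub continuous_const)
  rw [mvNormal_eq_map hC, integrable_map_measure hq.aestronglyMeasurable hc.aemeasurable]
  simp only [Function.comp_def, mvNormalPdf_quadratic_aux hC]
  exact integrable_pi_quadratic (fun _ => memLp_id_gaussianReal 2) _ _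

/-- The mean of a quadratic form in a normal vector. -/
theorem integral_mvNormal_quadratic (hC : C.PosDef) (μ c : Fin k → ℝ)
    (A : Matrix (Fin k) (Fin k) ℝ) :
    ∫ x, (x - c) ⬝ᵥ (A *ᵥ (x - c)) ∂mvNormal μ C =
      (μ - c) ⬝ᵥ (A *ᵥ (μ - c)) + (A * C).trace := by
  have hc : Continuous fun w : Fin k → ℝ => μ + psqrt C *ᵥ w := by fun_prop
  have hq : Continuous fun x : Fin k → ℝ => (x - c) ⬝ᵥ (A *ᵥ (x - c)) :=
    (continuous_quadratic A).comp (continuous_id.sub continuous_const)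
  rw [mvNormal_eq_map hC, integral_map hc.aemeasurable hq.aestronglyMeasurable]
  simp only [mvNormalPdf_quadratic_aux hC]
  rw [integral_pi_quadratic (fun _ => memLp_id_gaussianReal 2)]
  have hz : (fun i : Fin k => ∫ x, x ∂gaussianReal 0 1) = 0 := by
    funext i; simp
  have hv : Var[id; gaussianReal 0 1] = 1 := by simp
  simp only [hv, mul_one]
  rw [hz, ← mvNormalPdf_quadratic_aux hC, mulVec_zero, add_zero]
  congr 1
  change (psqrt C * A * psqrt C).trace = _
  rw [Matrix.mul_assoc, trace_mul_comm, Matrix.mul_assoc, (psqrt_spec hC).1]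

/-- Translates of normal distributions. -/
theorem map_add_mvNormal (hC : C.PosDef) (μ a : Fin k → ℝ) :
    (mvNormal μ C).map (fun x => a + x) = mvNormal (a + μ) C := by
  rw [mvNormal_eq_map hC, mvNormal_eq_map hC, Measure.map_map (by fun_prop)
    (by fun_prop : Continuous fun w : Fin k → ℝ => μ + psqrt C *ᵥ w).measurable]
  congr 1
  funext w
  simp [add_assoc]

end Gaussian

end Probit

end

/-! ### The truncated normal distribution on the line -/

noncomputable section

namespace Probit

section Truncated

/-- The probability that a `N(θ, 1)` variable lies in `halfLine y`. -/
def mass (θ : ℝ) (y : Bool) : ℝ := if y then stdCdf θ else 1 - stdCdf θ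

/-- The logarithmic derivative of `mass`. -/
def hazard (θ : ℝ) (y : Bool) : ℝ :=
  if y then stdPdf θ / stdCdf θ else -(stdPdf θ / (1 - stdCdf θ))

/-- The `N(θ, 1)` distribution truncated to `halfLine y`. -/
def truncNormal (θ : ℝ) (y : Bool) : Measure ℝ :=
  cond (gaussianReal θ 1) (halfLine y)

theorem measurableSet_halfLine (y : Bool) : MeasurableSet (halfLine y) := by
  unfold halfLine; split_ifs <;> simp

theorem gaussianReal_halfLine_ne_zero (θ : ℝ) (y : Bool) :
    gaussianReal θ 1 (halfLine y) ≠ 0 := by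
  intro h
  have := gaussianReal_absolutelyContinuous' θ (v := 1) one_ne_zero h
  unfold halfLine at this
  split_ifs at this <;> simp at this

/-- The reflection `x ↦ θ - x` carries `N(0, 1)` to `N(θ, 1)`. Open and closed half lines agree
since the measure has no atoms. -/
theorem gaussianReal_real_halfLine (θ : ℝ) (y : Bool) :
    (gaussianReal θ 1).real (halfLine y) = mass θ y := by
  have hna : NullSingletonClass (gaussianReal 0 1) := nullSingletonClass_gaussianReal one_ne_zero
  have h : gaussianReal θ 1 = (gaussianReal 0 1).map (fun x => θ - x) := by
    rw [gaussianReal_map_const_sub]; simp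
  have hm : Measurable fun x : ℝ => θ - x := by fun_prop
  rw [h, map_measureReal_apply hm (measurableSet_halfLine y)]
  unfold halfLine mass stdCdf
  rw [cdf_eq_real]
  split_ifs
  · have : (fun x : ℝ => θ - x) ⁻¹' Set.Ioi 0 = Set.Iio θ := by ext; simp
    rw [this]
    exact measureReal_congr Iio_ae_eq_Iic
  · have : (fun x : ℝ => θ - x) ⁻¹' Set.Iio 0 = (Set.Iic θ)ᶜ := by ext; simp
    rw [this, probReal_compl_eq_one_sub measurableSet_Iic]

theorem mass_pos (θ : ℝ) (y : Bool) : 0 < mass θ y := by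
  rw [← gaussianReal_real_halfLine]
  exact ENNReal.toReal_pos (gaussianReal_halfLine_ne_zero θ y) (measure_ne_top _ _)

theorem mass_le_one (θ : ℝ) (y : Bool) : mass θ y ≤ 1 := by
  rw [← gaussianReal_real_halfLine]
  exact measureReal_le_one

theorem stdPdf_pos (θ : ℝ) : 0 < stdPdf θ := gaussianPDFReal_pos _ _ _ one_ne_zero

theorem hasDerivAt_gaussianPDFReal (θ s : ℝ) :
    HasDerivAt (fun s => gaussianPDFReal θ 1 s) (-((s - θ) * gaussianPDFReal θ 1 s)) s := by
  have h : HasDerivAt (fun s : ℝ => -(s - θ) ^ 2 / (2 * ((1 : NNReal) : ℝ))) (-(s - θ)) s := by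
    have := ((((hasDerivAt_id s).sub_const θ).pow 2).neg).div_const (2 * ((1 : NNReal) : ℝ))
    refine HasDerivAt.congr_deriv this ?_
    simp
    ring
  have := (h.exp).const_mul (Real.sqrt (2 * Real.pi * ((1 : NNReal) : ℝ)))⁻¹
  refine HasDerivAt.congr_deriv this ?_
  rw [gaussianPDFReal]
  ring

theorem hasDerivAt_stdCdf (θ : ℝ) : HasDerivAt stdCdf (stdPdf θ) θ := by
  have hc : Continuous stdPdf :=
    continuous_iff_continuousAt.2 fun s => (hasDerivAt_gaussianPDFReal 0 s).continuousAt
  have h : stdCdf = fun t => stdCdf 0 + ∫ s in (0 : ℝ)..t, stdPdf s := by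
    funext t
    have e : ∀ u, stdCdf u = ∫ s in Set.Iic u, stdPdf s := by
      intro u
      rw [stdCdf, cdf_eq_real, measureReal_def, gaussianReal_apply_eq_integral _ one_ne_zero,
        ENNReal.toReal_ofReal (integral_nonneg fun s => gaussianPDFReal_nonneg _ _ _)]
      rfl
    have hi : Integrable stdPdf := integrable_gaussianPDFReal 0 1
    rw [e, e, ← intervalIntegral.integral_Iic_sub_Iic hi.integrableOn hi.integrableOn]
    ring
  rw [h]
  exact ((intervalIntegral.integral_hasDerivAt_right (hc.intervalIntegrable _ _)
    hc.aestronglyMeasurable.stronglyMeasurableAtFilter hc.continuousAt)).const_add _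

theorem hasDerivAt_mass (θ : ℝ) (y : Bool) :
    HasDerivAt (fun t => mass t y) (hazard θ y * mass θ y) θ := by
  have h := mass_pos θ y
  unfold mass hazard at *
  cases y
  · simp only [Bool.false_eq_true, if_false] at *
    rw [neg_mul, div_mul_cancel₀ _ h.ne']
    exact (hasDerivAt_stdCdf θ).const_sub 1
  · simp only [if_true] at *
    rw [div_mul_cancel₀ _ h.ne']
    exact hasDerivAt_stdCdf θ

theorem hasDerivAt_log_mass (θ : ℝ) (y : Bool) :
    HasDerivAt (fun t => Real.log (mass t y)) (hazard θ y) θ := by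
  have := (hasDerivAt_mass θ y).log (mass_pos θ y).ne'
  rwa [mul_div_cancel_right₀ _ (mass_pos θ y).ne'] at this

theorem hasDerivAt_hazard (θ : ℝ) (y : Bool) :
    HasDerivAt (fun t => hazard t y) (-(hazard θ y * (θ + hazard θ y))) θ := by
  have h : ∀ t, hazard t y = (if y then stdPdf t else -stdPdf t) / mass t y := by
    intro t; unfold hazard mass; cases y <;> simp [neg_div]
  have hp : HasDerivAt stdPdf (-(θ * stdPdf θ)) θ := by
    have := hasDerivAt_gaussianPDFReal 0 θ
    rwa [sub_zero] at this
  have hn : HasDerivAt (fun t => if y then stdPdf t else -stdPdf t)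
      (-(θ * if y then stdPdf θ else -stdPdf θ)) θ := by
    cases y
    · refine HasDerivAt.congr_deriv (f := fun t => -stdPdf t) hp.neg ?_
      simp
    · simpa using hp
  have hd := hn.div (hasDerivAt_mass θ y) (mass_pos θ y).ne'
  have hm := (mass_pos θ y).ne'
  refine (hd.congr_of_eventuallyEq (Filter.Eventually.of_forall fun t => h t)).congr_deriv ?_
  have e : (if y then stdPdf θ else -stdPdf θ) = hazard θ y * mass θ y := by
    rw [h θ, div_mul_cancel₀ _ hm]
  rw [e]
  field_simp
  ring

instance isProbabilityMeasure_truncNormal (θ : ℝ) (y : Bool) :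
    IsProbabilityMeasure (truncNormal θ y) :=
  cond_isProbabilityMeasure (gaussianReal_halfLine_ne_zero θ y)

theorem tnPdf_nonneg (θ : ℝ) (y : Bool) (t : ℝ) : 0 ≤ tnPdf θ y t :=
  Set.indicator_nonneg (fun _ _ => div_nonneg (gaussianPDFReal_nonneg _ _ _) measureReal_nonneg) t

theorem integrable_tnPdf (θ : ℝ) (y : Bool) : Integrable (tnPdf θ y) :=
  ((integrable_gaussianPDFReal θ 1).div_const _).indicator (measurableSet_halfLine y)

theorem truncNormal_eq_withDensity (θ : ℝ) (y : Bool) :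
    truncNormal θ y = volume.withDensity fun t => ENNReal.ofReal (tnPdf θ y t) := by
  have hpos : 0 < (gaussianReal θ 1).real (halfLine y) := by
    rw [gaussianReal_real_halfLine]; exact mass_pos θ y
  have hms := measurableSet_halfLine y
  have h : (fun t => ENNReal.ofReal (tnPdf θ y t)) =
      (halfLine y).indicator (fun t => (gaussianReal θ 1 (halfLine y))⁻¹ * gaussianPDF θ 1 t) := by
    funext t
    unfold tnPdf
    by_cases ht : t ∈ halfLine y
    · rw [Set.indicator_of_mem ht, Set.indicator_of_mem ht, ENNReal.ofReal_div_of_pos hpos,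
        ofReal_measureReal, div_eq_mul_inv, mul_comm]
      rfl
    · rw [Set.indicator_of_notMem ht, Set.indicator_of_notMem ht, ENNReal.ofReal_zero]
  rw [h, withDensity_indicator hms, truncNormal, ProbabilityTheory.cond,
    gaussianReal_of_var_ne_zero θ one_ne_zero, restrict_withDensity hms]
  exact (withDensity_smul _ (measurable_gaussianPDF θ 1)).symm

theorem integral_truncNormal (θ : ℝ) (y : Bool) (g : ℝ → ℝ) :
    ∫ t, g t ∂truncNormal θ y =
      (mass θ y)⁻¹ * ∫ t in halfLine y, gaussianPDFReal θ 1 t * g t := by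
  rw [truncNormal, ProbabilityTheory.cond, integral_smul_measure, ENNReal.toReal_inv,
    ← measureReal_def, gaussianReal_real_halfLine, smul_eq_mul]
  congr 1
  rw [← integral_indicator (measurableSet_halfLine y), ← integral_indicator
    (measurableSet_halfLine y), integral_gaussianReal_eq_integral_smul one_ne_zero]
  refine integral_congr_ae (Filter.Eventually.of_forall fun t => ?_)
  by_cases ht : t ∈ halfLine y <;> simp [ht]

/-- The fundamental theorem of calculus: an integrable function with integrable derivative vanishes
at infinity, so only the boundary value at `0` survives. It yields the first two truncated moments.
-/
theorem setIntegral_halfLine_of_hasDerivAt {f f' : ℝ → ℝ} (h : ∀ x, HasDerivAt f (f' x) x)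
    (hf : Integrable f) (hf' : Integrable f') (y : Bool) :
    ∫ t in halfLine y, f' t = if y then -f 0 else f 0 := by
  cases y
  · change ∫ t in Set.Iio 0, f' t = f 0
    rw [← integral_Iic_eq_integral_Iio, integral_Iic_of_hasDerivAt_of_tendsto' (fun x _ => h x)
      hf'.integrableOn (tendsto_zero_of_hasDerivAt_of_integrableOn_Iic (a := 0) (fun x _ => h x)
        hf'.integrableOn hf.integrableOn), sub_zero]
  · change ∫ t in Set.Ioi 0, f' t = -f 0
    rw [integral_Ioi_of_hasDerivAt_of_tendsto' (fun x _ => h x)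
      hf'.integrableOn (tendsto_zero_of_hasDerivAt_of_integrableOn_Ioi (a := 0) (fun x _ => h x)
        hf'.integrableOn hf.integrableOn), zero_sub]

theorem integrable_gaussianPDFReal_mul {θ : ℝ} {g : ℝ → ℝ}
    (hg : Integrable g (gaussianReal θ 1)) : Integrable fun t => gaussianPDFReal θ 1 t * g t := by
  rw [gaussianReal_of_var_ne_zero θ one_ne_zero, integrable_withDensity_iff_integrable_smul'
    (measurable_gaussianPDF θ 1)
    (Filter.Eventually.of_forall fun _ => gaussianPDF_lt_top)] at hg
  simpa [toReal_gaussianPDF] using hg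

theorem memLp_id_truncNormal (θ : ℝ) (y : Bool) : MemLp id 2 (truncNormal θ y) := by
  have h : MemLp id 2 (gaussianReal θ 1) := memLp_id_gaussianReal 2
  exact (h.restrict _).smul_measure (ENNReal.inv_ne_top.2 (gaussianReal_halfLine_ne_zero θ y))

theorem integrable_pdf_mul_id (θ : ℝ) : Integrable fun t => gaussianPDFReal θ 1 t * t :=
  integrable_gaussianPDFReal_mul (g := fun t => t)
    ((memLp_id_gaussianReal (μ := θ) (v := 1) 2).integrable (by norm_num))

theorem integrable_pdf_mul_sq (θ : ℝ) : Integrable fun t => gaussianPDFReal θ 1 t * t ^ 2 :=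
  integrable_gaussianPDFReal_mul (g := fun t => t ^ 2)
    (memLp_id_gaussianReal (μ := θ) (v := 1) 2).integrable_sq

theorem setIntegral_pdf (θ : ℝ) (y : Bool) :
    ∫ t in halfLine y, gaussianPDFReal θ 1 t = mass θ y := by
  have := integral_truncNormal θ y (fun _ => 1)
  simp only [integral_const, probReal_univ, smul_eq_mul, mul_one] at this
  have hm := (mass_pos θ y).ne'
  field_simp at this
  linarith

theorem integral_id_truncNormal (θ : ℝ) (y : Bool) :
    ∫ t, t ∂truncNormal θ y = θ + hazard θ y := by
  have hi := integrable_gaussianPDFReal θ 1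
  have h := setIntegral_halfLine_of_hasDerivAt (fun s => (hasDerivAt_gaussianPDFReal θ s)) hi
    (((integrable_pdf_mul_id θ).sub (hi.const_mul θ)).neg.congr
      (Filter.Eventually.of_forall fun t => by simp; ring)) y
  have e : ∫ t in halfLine y, gaussianPDFReal θ 1 t * t =
      θ * mass θ y - ∫ t in halfLine y, -((t - θ) * gaussianPDFReal θ 1 t) := by
    rw [← setIntegral_pdf, ← integral_const_mul, ← integral_sub (hi.const_mul θ).integrableOn
      (((integrable_pdf_mul_id θ).sub (hi.const_mul θ)).neg.congr
      (Filter.Eventually.of_forall fun t => by simp; ring)).integrableOn]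
    congr 1
    funext t
    ring
  have h0 : gaussianPDFReal θ 1 0 = stdPdf θ := by
    simp [gaussianPDFReal, stdPdf]
  have hm := (mass_pos θ y).ne'
  rw [integral_truncNormal, e, h, h0]
  unfold hazard
  cases y <;> simp only [mass, if_true, if_false, Bool.false_eq_true] at * <;> field_simp <;> ring

theorem integral_sq_truncNormal (θ : ℝ) (y : Bool) :
    ∫ t, t ^ 2 ∂truncNormal θ y = 1 + θ * (θ + hazard θ y) := by
  have hi := integrable_gaussianPDFReal θ 1
  have hd : Integrable fun t => gaussianPDFReal θ 1 t * t ^ 2 -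
      θ * (gaussianPDFReal θ 1 t * t) - gaussianPDFReal θ 1 t :=
    ((integrable_pdf_mul_sq θ).sub ((integrable_pdf_mul_id θ).const_mul θ)).sub hi
  -- This primitive vanishes at `0`, so there is no boundary term in the second moment.
  have h := setIntegral_halfLine_of_hasDerivAt (f := fun t => -(gaussianPDFReal θ 1 t * t))
    (f' := fun t => gaussianPDFReal θ 1 t * t ^ 2 - θ * (gaussianPDFReal θ 1 t * t) -
      gaussianPDFReal θ 1 t)
    (fun s => (((hasDerivAt_gaussianPDFReal θ s).mul (hasDerivAt_id s)).neg).congr_deriv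
      (by simp; ring)) (integrable_pdf_mul_id θ).neg hd y
  have hd' : Integrable fun t => gaussianPDFReal θ 1 t * t ^ 2 -
      θ * (gaussianPDFReal θ 1 t * t) :=
    (integrable_pdf_mul_sq θ).sub ((integrable_pdf_mul_id θ).const_mul θ)
  rw [integral_sub hd'.integrableOn hi.integrableOn,
    integral_sub (integrable_pdf_mul_sq θ).integrableOn
      ((integrable_pdf_mul_id θ).const_mul θ).integrableOn, integral_const_mul, setIntegral_pdf]
    at h
  have h1 := integral_id_truncNormal θ y
  have hm := (mass_pos θ y).ne'
  rw [integral_truncNormal] at h1 ⊢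
  rw [← h1]
  have h2 : ∫ t in halfLine y, gaussianPDFReal θ 1 t * t ^ 2 =
      θ * (∫ t in halfLine y, gaussianPDFReal θ 1 t * t) + mass θ y := by
    cases y <;> simp at h <;> linarith
  rw [h2]
  field_simp
  ring

theorem variance_truncNormal (θ : ℝ) (y : Bool) :
    Var[id; truncNormal θ y] = 1 - hazard θ y * (θ + hazard θ y) := by
  rw [variance_eq_sub (memLp_id_truncNormal θ y)]
  simp only [Pi.pow_apply, id]
  rw [integral_sq_truncNormal, integral_id_truncNormal]
  ring

/-- By `integral_id_truncNormal`, the second factor is the truncated mean. It has the sign of the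
half line, and so does `hazard`. -/
theorem hazard_mul_mean_nonneg (θ : ℝ) (y : Bool) : 0 ≤ hazard θ y * (θ + hazard θ y) := by
  have hm := mass_pos θ y
  have hp := stdPdf_pos θ
  rw [← integral_id_truncNormal, integral_truncNormal]
  have hs := measurableSet_halfLine y
  unfold hazard
  cases y
  · simp only [mass, if_false, Bool.false_eq_true] at *
    have : ∫ t in halfLine false, gaussianPDFReal θ 1 t * t ≤ 0 :=
      setIntegral_nonpos hs fun t ht => mul_nonpos_of_nonneg_of_nonpos
        (gaussianPDFReal_nonneg _ _ _) (by simp [halfLine] at ht; exact ht.le)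
    exact mul_nonneg_of_nonpos_of_nonpos (neg_nonpos.2 (by positivity))
      (mul_nonpos_of_nonneg_of_nonpos (by positivity) this)
  · simp only [mass, if_true] at *
    have : 0 ≤ ∫ t in halfLine true, gaussianPDFReal θ 1 t * t :=
      setIntegral_nonneg hs fun t ht => mul_nonneg
        (gaussianPDFReal_nonneg _ _ _) (by simp [halfLine] at ht; exact ht.le)
    positivity

theorem variance_truncNormal_le_one (θ : ℝ) (y : Bool) : Var[id; truncNormal θ y] ≤ 1 := by
  rw [variance_truncNormal]; linarith [hazard_mul_mean_nonneg θ y]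

/-- This is log-concavity of each likelihood factor, which makes the mode unique. -/
theorem antitone_hazard (y : Bool) : Antitone fun θ => hazard θ y :=
  antitone_of_hasDerivAt_nonpos (fun θ => hasDerivAt_hazard θ y)
    (fun θ => neg_nonpos.2 (hazard_mul_mean_nonneg θ y))

/-- The mean of the truncated normal distribution is `1`-Lipschitz in its location. -/
theorem abs_mean_sub_mean_le (y : Bool) (a b : ℝ) :
    |(a + hazard a y) - (b + hazard b y)| ≤ |a - b| := by
  have := Convex.norm_image_sub_le_of_norm_hasDerivWithin_le (f := fun t => t + hazard t y)
    (f' := fun t => 1 + -(hazard t y * (t + hazard t y))) (C := 1) (s := Set.univ) (x := b) (y := a)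
    (fun t _ => ((hasDerivAt_id t).add (hasDerivAt_hazard t y)).hasDerivWithinAt)
    (fun t _ => by
      have h1 := variance_nonneg id (truncNormal t y)
      rw [variance_truncNormal] at h1
      have h2 := hazard_mul_mean_nonneg t y
      rw [Real.norm_eq_abs, abs_le]
      constructor <;> linarith) convex_univ (Set.mem_univ _) (Set.mem_univ _)
  simpa using this

end Truncated

end Probit

end

/-! ### Positive definite matrices and the largest eigenvalue -/

noncomputable section

namespace Probit

section LinearAlgebra

variable {k : ℕ} {M : Matrix (Fin k) (Fin k) ℝ}

theorem quadratic_nonneg (hM : M.PosSemidef) (w : Fin k → ℝ) : 0 ≤ w ⬝ᵥ (M *ᵥ w) := by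
  simpa using hM.dotProduct_mulVec_nonneg w

theorem quadratic_pos (hM : M.PosDef) {w : Fin k → ℝ} (hw : w ≠ 0) : 0 < w ⬝ᵥ (M *ᵥ w) := by
  simpa using hM.dotProduct_mulVec_pos hw

theorem transpose_eq_of_posDef (hM : M.PosDef) : Mᵀ = M := by
  simpa using hM.isHermitian.eq

theorem isUnit_det_of_posDef (hM : M.PosDef) : IsUnit M.det :=
  isUnit_iff_ne_zero.2 hM.det_pos.ne'

theorem mulVec_inv_mulVec (hM : M.PosDef) (w : Fin k → ℝ) : M *ᵥ (M⁻¹ *ᵥ w) = w := by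
  rw [mulVec_mulVec, mul_nonsing_inv _ (isUnit_det_of_posDef hM), one_mulVec]

theorem inv_mulVec_mulVec (hM : M.PosDef) (w : Fin k → ℝ) : M⁻¹ *ᵥ (M *ᵥ w) = w := by
  rw [mulVec_mulVec, nonsing_inv_mul _ (isUnit_det_of_posDef hM), one_mulVec]

theorem dotProduct_mulVec_comm (hM : Mᵀ = M) (u w : Fin k → ℝ) :
    u ⬝ᵥ (M *ᵥ w) = w ⬝ᵥ (M *ᵥ u) := by
  rw [dotProduct_mulVec, ← mulVec_transpose, hM, dotProduct_comm]

theorem dotProduct_transpose_mulVec {q : ℕ} (X : Matrix (Fin k) (Fin q) ℝ) (u : Fin q → ℝ)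
    (w : Fin k → ℝ) : u ⬝ᵥ (Xᵀ *ᵥ w) = (X *ᵥ u) ⬝ᵥ w := by
  rw [dotProduct_mulVec, vecMul_transpose]

theorem quadratic_sub (hM : Mᵀ = M) (u w : Fin k → ℝ) :
    (u - w) ⬝ᵥ (M *ᵥ (u - w)) =
      u ⬝ᵥ (M *ᵥ u) - 2 * (u ⬝ᵥ (M *ᵥ w)) + w ⬝ᵥ (M *ᵥ w) := by
  rw [mulVec_sub, sub_dotProduct, dotProduct_sub, dotProduct_sub, dotProduct_mulVec_comm hM w u]
  ring

theorem sqNorm_eq_dotProduct (u : Fin k → ℝ) : sqNorm u = u ⬝ᵥ u := by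
  rw [sqNorm, EuclideanSpace.real_norm_sq_eq]
  simp [dotProduct, sq]

theorem sqNorm_invSqrt_mulVec (hM : M.PosDef) (u : Fin k → ℝ) :
    sqNorm (invSqrt M *ᵥ u) = u ⬝ᵥ (M⁻¹ *ᵥ u) := by
  obtain ⟨h1, h2, h3⟩ := psqrt_spec hM
  have e : invSqrt M = (psqrt M)⁻¹ := rfl
  rw [sqNorm_eq_dotProduct, e, ← dotProduct_transpose_mulVec, mulVec_mulVec, transpose_nonsing_inv,
    h2, ← Matrix.mul_inv_rev, h1]

theorem finite_spectrum (hM : M.PosDef) : (spectrum ℝ M).Finite := by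
  rw [hM.isHermitian.spectrum_real_eq_range_eigenvalues]
  exact Set.finite_range _

open scoped MatrixOrder in
theorem quadratic_le_lambdaMax (hM : M.PosDef) (w : Fin k → ℝ) :
    w ⬝ᵥ (M *ᵥ w) ≤ lambdaMax M * (w ⬝ᵥ w) := by
  have hsa : IsSelfAdjoint M := hM.isHermitian
  have h : M ≤ algebraMap ℝ _ (lambdaMax M) :=
    le_algebraMap_of_spectrum_le (fun t ht => le_csSup (finite_spectrum hM).bddAbove ht) hsa
  have := quadratic_nonneg (Matrix.le_iff.1 h) w
  rw [sub_mulVec, dotProduct_sub, Algebra.algebraMap_eq_smul_one, smul_mulVec, one_mulVec,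
    dotProduct_smul, smul_eq_mul] at this
  linarith

/-- The eigenvalue bound applied to the vector `M^(-1/2) w`. -/
theorem dotProduct_self_le_lambdaMax (hM : M.PosDef) (w : Fin k → ℝ) :
    w ⬝ᵥ w ≤ lambdaMax M * (w ⬝ᵥ (M⁻¹ *ᵥ w)) := by
  obtain ⟨h1, h2, h3⟩ := psqrt_spec hM
  have hR : IsUnit (psqrt M).det := isUnit_iff_ne_zero.2 h3.ne'
  have := quadratic_le_lambdaMax hM ((psqrt M)⁻¹ *ᵥ w)
  have e1 : ((psqrt M)⁻¹ *ᵥ w) ⬝ᵥ ((psqrt M)⁻¹ *ᵥ w) = w ⬝ᵥ (M⁻¹ *ᵥ w) := by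
    rw [← dotProduct_transpose_mulVec, mulVec_mulVec, transpose_nonsing_inv, h2,
      ← Matrix.mul_inv_rev, h1]
  have e2 : M *ᵥ ((psqrt M)⁻¹ *ᵥ w) = psqrt M *ᵥ w := by
    rw [mulVec_mulVec]
    congr 1
    calc M * (psqrt M)⁻¹ = psqrt M * psqrt M * (psqrt M)⁻¹ := by rw [h1]
      _ = psqrt M := by rw [Matrix.mul_assoc, mul_nonsing_inv _ hR, Matrix.mul_one]
  have e3 : ((psqrt M)⁻¹ *ᵥ w) ⬝ᵥ (psqrt M *ᵥ w) = w ⬝ᵥ w := by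
    rw [← dotProduct_transpose_mulVec, mulVec_mulVec, transpose_nonsing_inv, h2,
      nonsing_inv_mul _ hR, one_mulVec]
  rwa [e1, e2, e3] at this

/-- The largest eigenvalue is attained, unless the matrix is empty. -/
theorem lambdaMax_cases (hM : M.PosDef) :
    lambdaMax M = 0 ∨ ∃ w : Fin k → ℝ, w ≠ 0 ∧ M *ᵥ w = lambdaMax M • w := by
  rcases Set.eq_empty_or_nonempty (spectrum ℝ M) with h | h
  · left; rw [lambdaMax, h, Real.sSup_empty]
  · right
    have hmem : lambdaMax M ∈ spectrum ℝ M := h.csSup_mem (finite_spectrum hM)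
    rw [hM.isHermitian.spectrum_real_eq_range_eigenvalues] at hmem
    obtain ⟨i, hi⟩ := hmem
    refine ⟨_, fun h0 => ?_, by rw [← hi]; exact hM.isHermitian.mulVec_eigenvectorBasis i⟩
    apply hM.isHermitian.eigenvectorBasis.toBasis.ne_zero i
    ext j
    simpa using congrFun h0 j

theorem lambdaMax_nonneg (hM : M.PosDef) : 0 ≤ lambdaMax M := by
  rcases lambdaMax_cases hM with h | ⟨w, hw, h⟩
  · exact h.ge
  · have h1 := quadratic_pos hM hw
    have h2 : 0 ≤ w ⬝ᵥ w := by simpa using quadratic_nonneg PosSemidef.one w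
    rw [h, dotProduct_smul, smul_eq_mul] at h1
    by_contra hc
    nlinarith [mul_nonneg (neg_nonneg.2 (not_le.1 hc).le) h2]

end LinearAlgebra

/-! ### The matrix `X Σ⁻¹ Xᵀ` and its metric -/

section Design

variable {n p : ℕ} {X : Matrix (Fin n) (Fin p) ℝ} {Q : Matrix (Fin p) (Fin p) ℝ}

theorem posDef_Sig (hQ : Q.PosDef) : (Sig X Q).PosDef := by
  have := (posSemidef_conjTranspose_mul_self X)
  rw [conjTranspose_eq_transpose_of_trivial] at this
  exact PosDef.posSemidef_add this hQ

theorem transpose_mulVec_injective (hX : X.rank = n) : Function.Injective Xᵀ.mulVec := by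
  have h : LinearIndependent ℝ X.row := by
    rw [linearIndependent_iff_card_eq_finrank_span, Set.finrank, ← X.rank_eq_finrank_span_row, hX,
      Fintype.card_fin]
  have := vecMul_injective_iff.2 h
  intro a b hab
  apply this
  simpa [mulVec_transpose] using hab

theorem posDef_S (hQ : Q.PosDef) (hX : X.rank = n) : (S X Q).PosDef := by
  have hi : Function.Injective X.vecMul := fun a b hab =>
    transpose_mulVec_injective hX (by simpa [mulVec_transpose] using hab)
  have := (posDef_Sig (X := X) hQ).inv.mul_mul_conjTranspose_same hi
  rwa [conjTranspose_eq_transpose_of_trivial] at this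

theorem Sig_quadratic (u : Fin p → ℝ) :
    u ⬝ᵥ (Sig X Q *ᵥ u) = (X *ᵥ u) ⬝ᵥ (X *ᵥ u) + u ⬝ᵥ (Q *ᵥ u) := by
  rw [Sig, add_mulVec, dotProduct_add, ← mulVec_mulVec, dotProduct_transpose_mulVec]

theorem S_mulVec (w : Fin n → ℝ) : S X Q *ᵥ w = X *ᵥ ((Sig X Q)⁻¹ *ᵥ (Xᵀ *ᵥ w)) := by
  rw [S, ← mulVec_mulVec, ← mulVec_mulVec]

/-- With `x = Σ⁻¹ Xᵀ w` the form equals both `w · X x` and `|X x|² + x · Q x`. Expanding `|w - X x|²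
≥ 0` shows that it is at most `|w|² - x · Q x`, strictly smaller unless `x = 0`; in that case it is
zero. -/
theorem S_quadratic_lt (hQ : Q.PosDef) {w : Fin n → ℝ} (hw : w ≠ 0) :
    w ⬝ᵥ (S X Q *ᵥ w) < w ⬝ᵥ w := by
  have hG := posDef_Sig (X := X) hQ
  have hpos : ∀ u : Fin n → ℝ, 0 ≤ u ⬝ᵥ u := fun u => by
    simpa using quadratic_nonneg PosSemidef.one u
  obtain ⟨x, hx⟩ : ∃ x, x = (Sig X Q)⁻¹ *ᵥ (Xᵀ *ᵥ w) := ⟨_, rfl⟩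
  have hGx : Sig X Q *ᵥ x = Xᵀ *ᵥ w := by rw [hx, mulVec_inv_mulVec hG]
  have e1 : w ⬝ᵥ (S X Q *ᵥ w) = w ⬝ᵥ (X *ᵥ x) := by rw [S_mulVec, hx]
  have e2 : w ⬝ᵥ (X *ᵥ x) = (X *ᵥ x) ⬝ᵥ (X *ᵥ x) + x ⬝ᵥ (Q *ᵥ x) := by
    rw [← Sig_quadratic, hGx, dotProduct_transpose_mulVec, dotProduct_comm]
  have e3 : (w - X *ᵥ x) ⬝ᵥ (w - X *ᵥ x) =
      w ⬝ᵥ w - 2 * (w ⬝ᵥ (X *ᵥ x)) + (X *ᵥ x) ⬝ᵥ (X *ᵥ x) := by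
    have := quadratic_sub (M := (1 : Matrix (Fin n) (Fin n) ℝ)) transpose_one w (X *ᵥ x)
    simpa using this
  rw [e1]
  by_cases h0 : x = 0
  · rw [h0, mulVec_zero, dotProduct_zero]
    simpa using quadratic_pos PosDef.one hw
  · have := quadratic_pos hQ h0
    have := hpos (w - X *ᵥ x)
    linarith

theorem lambdaMax_S_lt_one (hQ : Q.PosDef) (hX : X.rank = n) : lambdaMax (S X Q) < 1 := by
  rcases lambdaMax_cases (posDef_S hQ hX) with h | ⟨w, hw, h⟩
  · rw [h]; exact one_pos
  · have h1 := S_quadratic_lt (X := X) hQ hw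
    have h2 : 0 < w ⬝ᵥ w := by simpa using quadratic_pos PosDef.one hw
    rw [h, dotProduct_smul, smul_eq_mul] at h1
    by_contra hc
    nlinarith [mul_nonneg (sub_nonneg.2 (not_lt.1 hc)) h2.le]

theorem lam_nonneg : 0 ≤ lam X Q := sq_nonneg _

theorem lam_lt_one (hQ : Q.PosDef) (hX : X.rank = n) : lam X Q < 1 := by
  have h1 := lambdaMax_S_lt_one hQ hX
  have h0 := lambdaMax_nonneg (posDef_S hQ hX)
  exact pow_lt_one₀ h0 h1 two_ne_zero

theorem L_nonneg : 0 ≤ L X Q :=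
  mul_nonneg (Nat.cast_nonneg n) (by linarith [lam_nonneg (X := X) (Q := Q)])

theorem S_diag_nonneg (hQ : Q.PosDef) (hX : X.rank = n) (i : Fin n) : 0 ≤ S X Q i i :=
  (posDef_S hQ hX).posSemidef.diag_nonneg

theorem trace_S_le (hQ : Q.PosDef) : (S X Q).trace ≤ n := by
  have h : ∀ i, S X Q i i ≤ 1 := by
    intro i
    have h1 := S_quadratic_lt (X := X) hQ (w := Pi.single i (1 : ℝ)) (by simp)
    simp at h1
    exact h1.le
  calc (S X Q).trace = ∑ i, S X Q i i := rfl
    _ ≤ ∑ _i : Fin n, (1 : ℝ) := Finset.sum_le_sum fun i _ => h i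
    _ = n := by simp

/-- The squared distance of `u` to `0` in the metric given by `(X Σ⁻¹ Xᵀ)⁻¹`. -/
def dist2 (X : Matrix (Fin n) (Fin p) ℝ) (Q : Matrix (Fin p) (Fin p) ℝ) (u : Fin n → ℝ) : ℝ :=
  u ⬝ᵥ ((S X Q)⁻¹ *ᵥ u)

theorem dist2_nonneg (hQ : Q.PosDef) (hX : X.rank = n) (u : Fin n → ℝ) : 0 ≤ dist2 X Q u :=
  quadratic_nonneg (posDef_S hQ hX).inv.posSemidef u

theorem dist2_S_mulVec (hQ : Q.PosDef) (hX : X.rank = n) (u : Fin n → ℝ) :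
    dist2 X Q (S X Q *ᵥ u) = u ⬝ᵥ (S X Q *ᵥ u) := by
  rw [dist2, inv_mulVec_mulVec (posDef_S hQ hX), dotProduct_comm]

/-- A coordinatewise contraction followed by `X Σ⁻¹ Xᵀ` contracts `dist2` by the factor `lam`. -/
theorem dist2_S_mulVec_le (hQ : Q.PosDef) (hX : X.rank = n) {u t : Fin n → ℝ}
    (h : ∀ i, |u i| ≤ |t i|) : dist2 X Q (S X Q *ᵥ u) ≤ lam X Q * dist2 X Q t := by
  have hS := posDef_S hQ hX
  have h0 := lambdaMax_nonneg hS
  have hut : u ⬝ᵥ u ≤ t ⬝ᵥ t := by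
    refine Finset.sum_le_sum fun i _ => ?_
    have := mul_self_le_mul_self (abs_nonneg _) (h i)
    rwa [abs_mul_abs_self, abs_mul_abs_self] at this
  rw [dist2_S_mulVec hQ hX]
  calc u ⬝ᵥ (S X Q *ᵥ u) ≤ lambdaMax (S X Q) * (u ⬝ᵥ u) := quadratic_le_lambdaMax hS u
    _ ≤ lambdaMax (S X Q) * (lambdaMax (S X Q) * (t ⬝ᵥ ((S X Q)⁻¹ *ᵥ t))) := by
        gcongr
        exact hut.trans (dotProduct_self_le_lambdaMax hS t)
    _ = _ := by rw [lam, dist2]; ring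

theorem S_transpose (hQ : Q.PosDef) (hX : X.rank = n) : ((S X Q)⁻¹)ᵀ = (S X Q)⁻¹ :=
  transpose_eq_of_posDef (posDef_S hQ hX).inv

/-- The precision matrix of the minorizing normal distribution. -/
def minPrec (X : Matrix (Fin n) (Fin p) ℝ) (Q : Matrix (Fin p) (Fin p) ℝ) :
    Matrix (Fin p) (Fin p) ℝ := Sig X Q + Xᵀ * (S X Q)⁻¹ * X

theorem minPrec_quadratic (u : Fin p → ℝ) :
    u ⬝ᵥ (minPrec X Q *ᵥ u) = u ⬝ᵥ (Sig X Q *ᵥ u) + dist2 X Q (X *ᵥ u) := by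
  rw [minPrec, add_mulVec, dotProduct_add, ← mulVec_mulVec, ← mulVec_mulVec,
    dotProduct_transpose_mulVec, dist2]

theorem posDef_minPrec (hQ : Q.PosDef) (hX : X.rank = n) : (minPrec X Q).PosDef := by
  have := (posDef_S hQ hX).inv.posSemidef.conjTranspose_mul_mul_same X
  rw [conjTranspose_eq_transpose_of_trivial] at this
  exact (posDef_Sig hQ).add_posSemidef this

/-- After `Σ` is factored out, Sylvester's identity `det (1 + A B) = det (1 + B A)` passes to size
`n`, where `B A = S⁻¹ S = 1`. -/
theorem det_minPrec (hQ : Q.PosDef) (hX : X.rank = n) :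
    (minPrec X Q).det = 2 ^ n * (Sig X Q).det := by
  have hG := isUnit_det_of_posDef (posDef_Sig (X := X) hQ)
  have hS := isUnit_det_of_posDef (posDef_S hQ hX)
  have e : minPrec X Q = Sig X Q * (1 + (Sig X Q)⁻¹ * Xᵀ * ((S X Q)⁻¹ * X)) := by
    rw [Matrix.mul_add, Matrix.mul_one, ← Matrix.mul_assoc, ← Matrix.mul_assoc, ← Matrix.mul_assoc,
      mul_nonsing_inv _ hG, Matrix.one_mul, minPrec]
  have e2 : (S X Q)⁻¹ * X * ((Sig X Q)⁻¹ * Xᵀ) = 1 := by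
    rw [Matrix.mul_assoc, ← Matrix.mul_assoc X]
    exact nonsing_inv_mul _ hS
  rw [e, det_mul, det_one_add_mul_comm, e2, ← two_smul ℝ (1 : Matrix (Fin n) (Fin n) ℝ), det_smul,
    det_one]
  simp [mul_comm]

/-- The point with the same image under `X` as `μ` that is closest to `b`. -/
def nearest (X : Matrix (Fin n) (Fin p) ℝ) (Q : Matrix (Fin p) (Fin p) ℝ) (b μ : Fin p → ℝ) :
    Fin p → ℝ := b + (Sig X Q)⁻¹ *ᵥ (Xᵀ *ᵥ ((S X Q)⁻¹ *ᵥ (X *ᵥ (μ - b))))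

theorem mulVec_nearest (hQ : Q.PosDef) (hX : X.rank = n) (b μ : Fin p → ℝ) :
    X *ᵥ nearest X Q b μ = X *ᵥ μ := by
  rw [nearest, mulVec_add, ← S_mulVec, mulVec_inv_mulVec (posDef_S hQ hX), mulVec_sub]
  abel

/-- With `c = x - b` and `a = X (μ - b)`, the right side minus the left is the `S⁻¹`-form of `X c +
a`, hence nonnegative. -/
theorem nearest_quadratic_le (hQ : Q.PosDef) (hX : X.rank = n) (b μ x : Fin p → ℝ) :
    (x - nearest X Q b μ) ⬝ᵥ (Sig X Q *ᵥ (x - nearest X Q b μ)) ≤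
      (x - b) ⬝ᵥ (minPrec X Q *ᵥ (x - b)) + 2 * dist2 X Q (X *ᵥ (μ - b)) := by
  have hG := posDef_Sig (X := X) hQ
  have hS := posDef_S hQ hX
  rw [minPrec_quadratic, nearest, ← sub_sub]
  generalize x - b = c
  generalize X *ᵥ (μ - b) = a
  have h := dist2_nonneg hQ hX (X *ᵥ c + a)
  have e : dist2 X Q (X *ᵥ c + a) =
      dist2 X Q (X *ᵥ c) + 2 * ((X *ᵥ c) ⬝ᵥ ((S X Q)⁻¹ *ᵥ a)) + dist2 X Q a := by
    simp only [dist2]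
    rw [mulVec_add, add_dotProduct, dotProduct_add, dotProduct_add,
      dotProduct_mulVec_comm (S_transpose hQ hX) a]
    ring
  rw [quadratic_sub (transpose_eq_of_posDef hG), mulVec_inv_mulVec hG, dotProduct_transpose_mulVec,
    dotProduct_transpose_mulVec, ← S_mulVec, mulVec_inv_mulVec hS]
  have e2 : a ⬝ᵥ ((S X Q)⁻¹ *ᵥ a) = dist2 X Q a := rfl
  rw [e2]
  linarith

/-- Completing the square in the joint density. -/
theorem joint_quadratic (hQ : Q.PosDef) (v β : Fin p → ℝ) (z : Fin n → ℝ) :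
    (z - X *ᵥ β) ⬝ᵥ (z - X *ᵥ β) + (β - v) ⬝ᵥ (Q *ᵥ (β - v)) =
      (β - condMean X Q v z) ⬝ᵥ (Sig X Q *ᵥ (β - condMean X Q v z)) +
        (z ⬝ᵥ z + v ⬝ᵥ (Q *ᵥ v) -
          condMean X Q v z ⬝ᵥ (Sig X Q *ᵥ condMean X Q v z)) := by
  have hG := posDef_Sig (X := X) hQ
  have e1 : (z - X *ᵥ β) ⬝ᵥ (z - X *ᵥ β) =
      z ⬝ᵥ z - 2 * ((X *ᵥ β) ⬝ᵥ z) + (X *ᵥ β) ⬝ᵥ (X *ᵥ β) := by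
    have := quadratic_sub (M := (1 : Matrix (Fin n) (Fin n) ℝ)) transpose_one z (X *ᵥ β)
    rw [dotProduct_comm z (1 *ᵥ X *ᵥ β)] at this
    simpa using this
  have e2 : Sig X Q *ᵥ condMean X Q v z = Xᵀ *ᵥ z + Q *ᵥ v := by
    rw [condMean, mulVec_inv_mulVec hG]
  rw [e1, quadratic_sub (transpose_eq_of_posDef hQ), quadratic_sub (transpose_eq_of_posDef hG),
    Sig_quadratic β, e2, dotProduct_add, dotProduct_transpose_mulVec]
  ring

end Design

end Probit

end

/-! ### Existence, uniqueness and fixed-point property of the posterior mode -/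

noncomputable section

namespace Probit

section Mode

variable {n p : ℕ} {X : Matrix (Fin n) (Fin p) ℝ} {Y : Fin n → Bool}
  {Q : Matrix (Fin p) (Fin p) ℝ} {v : Fin p → ℝ}

theorem likelihood_eq (β : Fin p → ℝ) : likelihood X Y β = ∏ i, mass (X i ⬝ᵥ β) (Y i) := rfl

theorem likelihood_pos (β : Fin p → ℝ) : 0 < likelihood X Y β :=
  Finset.prod_pos fun _ _ => mass_pos _ _

theorem likelihood_le_one (β : Fin p → ℝ) : likelihood X Y β ≤ 1 :=
  Finset.prod_le_one (fun _ _ => (mass_pos _ _).le) fun _ _ => mass_le_one _ _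

theorem continuous_mass (y : Bool) : Continuous fun θ => mass θ y :=
  continuous_iff_continuousAt.2 fun θ => (hasDerivAt_mass θ y).continuousAt

theorem continuous_likelihood : Continuous (likelihood X Y) := by
  refine continuous_finsetProd _ fun i _ => (continuous_mass (Y i)).comp ?_
  change Continuous fun β => X i ⬝ᵥ β
  fun_prop

theorem prior_pos (β : Fin p → ℝ) : 0 < prior Q v β := Real.exp_pos _

theorem continuous_prior : Continuous (prior Q v) := by
  have : Continuous fun β : Fin p → ℝ => (β - v) ⬝ᵥ (Q *ᵥ (β - v)) :=
    (continuous_quadratic Q).comp (continuous_id.sub continuous_const)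
  unfold prior
  fun_prop

theorem prior_eq (hQ : Q.PosDef) (β : Fin p → ℝ) :
    prior Q v β = Real.sqrt ((2 * Real.pi) ^ p * Q⁻¹.det) * mvNormalPdf v Q⁻¹ β := by
  have h : 0 < Q⁻¹.det := hQ.inv.det_pos
  rw [mvNormalPdf, nonsing_inv_nonsing_inv _ (isUnit_det_of_posDef hQ), ← mul_assoc,
    mul_inv_cancel₀ (by positivity), one_mul, prior]

/-- A density of a finite measure is integrable. -/
theorem integrable_of_isFiniteMeasure_withDensity {α : Type*} [MeasurableSpace α] {μ : Measure α}
    {f : α → ℝ} (hm : Measurable f) (h0 : ∀ x, 0 ≤ f x)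
    (h : IsFiniteMeasure (μ.withDensity fun x => ENNReal.ofReal (f x))) : Integrable f μ := by
  refine ⟨hm.aestronglyMeasurable, ?_⟩
  rw [hasFiniteIntegral_iff_ofReal (Filter.Eventually.of_forall h0), ← setLIntegral_univ,
    ← withDensity_apply _ MeasurableSet.univ]
  exact measure_lt_top _ _

theorem integrable_mvNormalPdf {k : ℕ} {C : Matrix (Fin k) (Fin k) ℝ} (hC : C.PosDef)
    (μ : Fin k → ℝ) : Integrable (mvNormalPdf μ C) := by
  have hm : Measurable (mvNormalPdf μ C) :=
    ((continuous_mvNormalPdf C).comp (Continuous.prodMk_right μ)).measurable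
  have := isProbabilityMeasure_mvNormal hC μ
  exact integrable_of_isFiniteMeasure_withDensity hm (mvNormalPdf_nonneg μ C)
    (inferInstanceAs (IsFiniteMeasure (mvNormal μ C)))

theorem integrable_prior (hQ : Q.PosDef) : Integrable (prior Q v) := by
  have : prior Q v = fun β => Real.sqrt ((2 * Real.pi) ^ p * Q⁻¹.det) * mvNormalPdf v Q⁻¹ β :=
    funext (prior_eq hQ)
  rw [this]
  exact (integrable_mvNormalPdf hQ.inv v).const_mul _

/-- The unnormalized posterior density. -/
def weight (X : Matrix (Fin n) (Fin p) ℝ) (Y : Fin n → Bool) (Q : Matrix (Fin p) (Fin p) ℝ)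
    (v : Fin p → ℝ) (β : Fin p → ℝ) : ℝ := likelihood X Y β * prior Q v β

theorem weight_pos (β : Fin p → ℝ) : 0 < weight X Y Q v β :=
  mul_pos (likelihood_pos β) (prior_pos β)

theorem weight_le_prior (β : Fin p → ℝ) : weight X Y Q v β ≤ prior Q v β :=
  mul_le_of_le_one_left (prior_pos β).le (likelihood_le_one β)

theorem continuous_weight : Continuous (weight X Y Q v) :=
  continuous_likelihood.mul continuous_prior

theorem integrable_weight (hQ : Q.PosDef) : Integrable (weight X Y Q v) :=
  (integrable_prior hQ).mono' continuous_weight.aestronglyMeasurable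
    (Filter.Eventually.of_forall fun β => by
      rw [Real.norm_of_nonneg (weight_pos β).le]; exact weight_le_prior β)

theorem integral_weight_pos (hQ : Q.PosDef) : 0 < ∫ β, weight X Y Q v β := by
  rw [integral_pos_iff_support_of_nonneg (fun β => (weight_pos β).le) (integrable_weight hQ)]
  have : Function.support (weight X Y Q v) = Set.univ :=
    Set.eq_univ_of_forall fun β => (weight_pos β).ne'
  rw [this]
  exact isOpen_univ.measure_pos _ Set.univ_nonempty

theorem posterior_eq (β : Fin p → ℝ) :
    posterior X Y Q v β = weight X Y Q v β / ∫ b, weight X Y Q v b := rfl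

theorem isPosteriorMode_iff (hQ : Q.PosDef) (b : Fin p → ℝ) :
    IsPosteriorMode X Y Q v b ↔ ∀ β, weight X Y Q v β ≤ weight X Y Q v b := by
  simp only [IsPosteriorMode, posterior_eq, div_le_div_iff_of_pos_right (integral_weight_pos hQ)]

/-- Coercivity: the unnormalized posterior is dominated by the prior, which outside a large ball is
below the value of the posterior at `v`. -/
theorem exists_isPosteriorMode (hQ : Q.PosDef) : ∃ b, IsPosteriorMode X Y Q v b := by
  simp only [isPosteriorMode_iff hQ]
  refine continuous_weight.exists_forall_ge' v ?_
  have h0 : (0 : ℝ) < -Real.log (weight X Y Q v v) + 1 := by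
    have h1 : weight X Y Q v v ≤ 1 := (weight_le_prior v).trans (by simp [prior])
    have := Real.log_nonpos (weight_pos v).le h1
    linarith
  -- Chosen so that `exp (-c)` is below the weight at `v`; the added `1` keeps `c` positive even
  -- when that weight is `1`.
  obtain ⟨c, hc⟩ : ∃ c, c = -Real.log (weight X Y Q v v) + 1 := ⟨_, rfl⟩
  have hq : Filter.Tendsto (fun β : Fin p → ℝ => ‖β‖) (Filter.cocompact _) Filter.atTop :=
    tendsto_norm_cocompact_atTop
  have hl := lambdaMax_nonneg hQ.inv
  obtain ⟨ℓ, hℓ⟩ : ∃ ℓ, ℓ = lambdaMax Q⁻¹ := ⟨_, rfl⟩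
  filter_upwards [hq.eventually_gt_atTop (‖v‖ + (2 * ℓ * c + 1))] with β hβ
  have h1 := dotProduct_self_le_lambdaMax hQ.inv (β - v)
  rw [nonsing_inv_nonsing_inv _ (isUnit_det_of_posDef hQ), ← hℓ] at h1
  rw [← hℓ] at hl
  have h2 : ‖β‖ ≤ ‖v‖ + ‖β - v‖ := norm_le_insert' β v |>.trans (by rw [norm_sub_rev])
  have h3 : 2 * ℓ * c + 1 < ‖β - v‖ := by linarith
  have h4 : ‖β - v‖ ^ 2 ≤ (β - v) ⬝ᵥ (β - v) := by
    have hb : ‖β - v‖ ≤ Real.sqrt ((β - v) ⬝ᵥ (β - v)) := by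
      refine (pi_norm_le_iff_of_nonneg (Real.sqrt_nonneg _)).2 fun i => ?_
      refine Real.le_sqrt_of_sq_le ?_
      rw [Real.norm_eq_abs, sq_abs, sq]
      exact Finset.single_le_sum (f := fun i => (β - v) i * (β - v) i)
        (fun i _ => mul_self_nonneg _) (Finset.mem_univ i)
    calc _ ≤ Real.sqrt ((β - v) ⬝ᵥ (β - v)) ^ 2 := by gcongr
      _ = _ := Real.sq_sqrt (Finset.sum_nonneg fun i _ => mul_self_nonneg _)
  have hcpos : 0 < c := by rw [hc]; exact h0
  have h5 : 2 * c ≤ (β - v) ⬝ᵥ (Q *ᵥ (β - v)) := by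
    by_contra hcon
    rw [not_le] at hcon
    have h6 : ‖β - v‖ ^ 2 ≤ ℓ * (2 * c) := h4.trans (h1.trans (by gcongr))
    have h7 : 0 ≤ ℓ * c := by positivity
    nlinarith
  refine (weight_le_prior β).trans ?_
  rw [prior, ← Real.exp_log (weight_pos v)]
  apply Real.exp_le_exp.2
  linarith

theorem log_weight (β : Fin p → ℝ) :
    Real.log (weight X Y Q v β) =
      ∑ i, Real.log (mass (X i ⬝ᵥ β) (Y i)) + -(1 / 2) * ((β - v) ⬝ᵥ (Q *ᵥ (β - v))) := by
  rw [weight, Real.log_mul (likelihood_pos β).ne' (prior_pos β).ne', likelihood_eq,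
    Real.log_prod fun i _ => (mass_pos _ _).ne', prior, Real.log_exp]

/-- The gradient of the logarithmic posterior density vanishes at the mode. -/
theorem IsPosteriorMode.stationary (hQ : Q.PosDef) {b : Fin p → ℝ}
    (hb : IsPosteriorMode X Y Q v b) :
    Q *ᵥ (b - v) = Xᵀ *ᵥ fun i => hazard (X i ⬝ᵥ b) (Y i) := by
  rw [isPosteriorMode_iff hQ] at hb
  have key : ∀ h : Fin p → ℝ,
      h ⬝ᵥ (Xᵀ *ᵥ fun i => hazard (X i ⬝ᵥ b) (Y i)) - h ⬝ᵥ (Q *ᵥ (b - v)) = 0 := by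
    intro h
    -- Stationarity is tested on lines through `b`, so only one-variable derivatives are needed.
    have hmax : IsLocalMax (fun t : ℝ => Real.log (weight X Y Q v (b + t • h))) 0 :=
      Filter.Eventually.of_forall fun t => by
        simp only [zero_smul, add_zero]
        exact Real.log_le_log (weight_pos _) (hb _)
    refine hmax.hasDerivAt_eq_zero ?_
    have e : (fun t : ℝ => Real.log (weight X Y Q v (b + t • h))) = fun t =>
        ∑ i, Real.log (mass (X i ⬝ᵥ b + t * (X i ⬝ᵥ h)) (Y i)) +
          -(1 / 2) * ((b - v) ⬝ᵥ (Q *ᵥ (b - v)) + 2 * t * (h ⬝ᵥ (Q *ᵥ (b - v))) +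
            t ^ 2 * (h ⬝ᵥ (Q *ᵥ h))) := by
      funext t
      rw [log_weight]
      congr 1
      · simp only [dotProduct_add, dotProduct_smul, smul_eq_mul]
      · have : b + t • h - v = (b - v) + t • h := by abel
        rw [this, mulVec_add, add_dotProduct, dotProduct_add, dotProduct_add,
          dotProduct_mulVec_comm (transpose_eq_of_posDef hQ) (b - v) (t • h), mulVec_smul,
          smul_dotProduct, smul_dotProduct, dotProduct_smul]
        simp only [smul_eq_mul]
        ring
    rw [e]
    have hd : HasDerivAt (fun t : ℝ => ∑ i, Real.log (mass (X i ⬝ᵥ b + t * (X i ⬝ᵥ h)) (Y i)))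
        (∑ i, hazard (X i ⬝ᵥ b) (Y i) * (X i ⬝ᵥ h)) 0 := by
      refine HasDerivAt.fun_sum fun i _ => ?_
      have h1 : HasDerivAt (fun t : ℝ => X i ⬝ᵥ b + t * (X i ⬝ᵥ h)) (X i ⬝ᵥ h) 0 := by
        simpa using ((hasDerivAt_id (0 : ℝ)).mul_const (X i ⬝ᵥ h)).const_add (X i ⬝ᵥ b)
      have h2 := hasDerivAt_log_mass (X i ⬝ᵥ b + 0 * (X i ⬝ᵥ h)) (Y i)
      have h3 := HasDerivAt.comp (0 : ℝ) h2 h1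
      refine HasDerivAt.congr_deriv h3 ?_
      rw [zero_mul, add_zero]
    have hd2 : HasDerivAt (fun t : ℝ => -(1 / 2) * ((b - v) ⬝ᵥ (Q *ᵥ (b - v)) +
        2 * t * (h ⬝ᵥ (Q *ᵥ (b - v))) + t ^ 2 * (h ⬝ᵥ (Q *ᵥ h)))) (-(h ⬝ᵥ (Q *ᵥ (b - v)))) 0 := by
      have h1 := (((hasDerivAt_id (0 : ℝ)).const_mul 2).mul_const (h ⬝ᵥ (Q *ᵥ (b - v)))).const_add
        ((b - v) ⬝ᵥ (Q *ᵥ (b - v)))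
      have h2 := ((hasDerivAt_id (0 : ℝ)).pow 2).mul_const (h ⬝ᵥ (Q *ᵥ h))
      refine HasDerivAt.congr_deriv ((h1.add h2).const_mul (-(1 / 2))) ?_
      simp
    refine (hd.add hd2).congr_deriv ?_
    rw [dotProduct_transpose_mulVec, sub_eq_add_neg]
    exact congrArg (· + _) (Finset.sum_congr rfl fun i _ => mul_comm _ _)
  have := dotProduct_eq (Q *ᵥ (b - v)) (Xᵀ *ᵥ fun i => hazard (X i ⬝ᵥ b) (Y i)) fun h => by
    have := key h
    rw [dotProduct_comm, dotProduct_comm _ h]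
    linarith
  exact this

/-- Subtract the stationarity equations of two modes and pair with `b - c`: the prior gives a
positive quadratic form, while the decreasing hazards give a nonpositive sum. -/
theorem IsPosteriorMode.unique (hQ : Q.PosDef) {b c : Fin p → ℝ}
    (hb : IsPosteriorMode X Y Q v b) (hc : IsPosteriorMode X Y Q v c) : b = c := by
  by_contra hbc
  have h1 := quadratic_pos hQ (sub_ne_zero.2 hbc)
  have e : Q *ᵥ (b - c) = Xᵀ *ᵥ ((fun i => hazard (X i ⬝ᵥ b) (Y i)) -
      fun i => hazard (X i ⬝ᵥ c) (Y i)) := by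
    rw [mulVec_sub Xᵀ, ← hb.stationary hQ, ← hc.stationary hQ, ← mulVec_sub]
    congr 1
    abel
  rw [e, dotProduct_transpose_mulVec, mulVec_sub] at h1
  refine absurd h1 (not_lt.2 (Finset.sum_nonpos fun i _ => ?_))
  change (X i ⬝ᵥ b - X i ⬝ᵥ c) * (hazard (X i ⬝ᵥ b) (Y i) - hazard (X i ⬝ᵥ c) (Y i)) ≤ 0
  rcases le_total (X i ⬝ᵥ b) (X i ⬝ᵥ c) with h | h
  · exact mul_nonpos_of_nonpos_of_nonneg (by linarith)
      (by have := antitone_hazard (Y i) h; simp only at this; linarith)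
  · exact mul_nonpos_of_nonneg_of_nonpos (by linarith)
      (by have := antitone_hazard (Y i) h; simp only at this; linarith)

/-- The mean of the latent vector given the regression coefficients. -/
def tnMean (X : Matrix (Fin n) (Fin p) ℝ) (Y : Fin n → Bool) (β : Fin p → ℝ) (i : Fin n) : ℝ :=
  X i ⬝ᵥ β + hazard (X i ⬝ᵥ β) (Y i)

/-- The mode is a fixed point of the two conditional means. -/
theorem IsPosteriorMode.condMean_tnMean (hQ : Q.PosDef) {b : Fin p → ℝ}
    (hb : IsPosteriorMode X Y Q v b) : condMean X Q v (tnMean X Y b) = b := by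
  have hG := posDef_Sig (X := X) hQ
  have e : Xᵀ *ᵥ tnMean X Y b + Q *ᵥ v = Sig X Q *ᵥ b := by
    have h1 : tnMean X Y b = X *ᵥ b + fun i => hazard (X i ⬝ᵥ b) (Y i) := rfl
    rw [h1, mulVec_add, ← hb.stationary hQ, mulVec_sub, Sig, add_mulVec, mulVec_mulVec]
    abel
  rw [condMean, e, inv_mulVec_mulVec hG]

end Mode

end Probit

end

/-! ### The two conditional draws as Markov kernels -/

noncomputable section

namespace Probit

section Bind

variable {α β : Type*} [MeasurableSpace α] [MeasurableSpace β]

theorem integral_comp_measure {κ : Kernel α β} {μ : Measure α} {f : β → ℝ}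
    (hf : Integrable f (κ ∘ₘ μ)) : ∫ y, f y ∂(κ ∘ₘ μ) = ∫ x, avg κ f x ∂μ := by
  rw [Measure.comp_eq_comp_const_apply] at hf ⊢
  rw [Kernel.integral_comp hf]
  simp [avg]

/-- Mixing densities. -/
theorem comp_withDensity {μ : Measure α} {ν : Measure β} [SFinite μ] [SFinite ν] {κ : Kernel α β}
    {k : α → β → ENNReal} (hk : Measurable (Function.uncurry k))
    (hκ : ∀ a, κ a = ν.withDensity (k a)) {f : α → ENNReal} (hf : Measurable f) :
    κ ∘ₘ (μ.withDensity f) = ν.withDensity fun b => ∫⁻ a, f a * k a b ∂μ := by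
  ext s hs
  have hκm : Measurable fun a => κ a s := Kernel.measurable_coe κ hs
  rw [Measure.bind_apply hs κ.aemeasurable, withDensity_apply _ hs,
    lintegral_withDensity_eq_lintegral_mul _ hf hκm, lintegral_lintegral_swap]
  · refine lintegral_congr fun a => ?_
    rw [Pi.mul_apply, hκ, withDensity_apply _ hs, lintegral_const_mul _ hk.of_uncurry_left]
  · have : Measurable fun q : β × α => f q.2 * k q.2 q.1 :=
      (hf.comp measurable_snd).mul (hk.comp measurable_swap)
    exact this.aemeasurable

/-- Bayes' rule for densities. -/
theorem comp_withDensity_eq {μ : Measure α} {ν : Measure β} [SFinite μ] [SFinite ν]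
    {κ : Kernel α β} {k : α → β → ENNReal} (hk : Measurable (Function.uncurry k))
    (hκ : ∀ a, κ a = ν.withDensity (k a)) {f : α → ENNReal} (hf : Measurable f)
    {g : β → ENNReal} {l : β → α → ENNReal} (hl : Measurable (Function.uncurry l))
    (hl1 : ∀ b, ∫⁻ a, l b a ∂μ = 1) (h : ∀ a b, f a * k a b = g b * l b a) :
    κ ∘ₘ (μ.withDensity f) = ν.withDensity g := by
  rw [comp_withDensity hk hκ hf]
  congr 1
  funext b
  simp only [h]
  rw [lintegral_const_mul _ hl.of_uncurry_left, hl1, mul_one]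

end Bind

section Chain

variable {n p : ℕ} {X : Matrix (Fin n) (Fin p) ℝ} {Y : Fin n → Bool}
  {Q : Matrix (Fin p) (Fin p) ℝ} {v : Fin p → ℝ}

theorem measurable_tnPdf (y : Bool) : Measurable fun q : ℝ × ℝ => tnPdf q.1 y q.2 := by
  have h : (fun q : ℝ × ℝ => tnPdf q.1 y q.2) = (Prod.snd ⁻¹' halfLine y).indicator
      fun q : ℝ × ℝ => gaussianPDFReal q.1 1 q.2 / mass q.1 y := by
    funext q
    simp only [tnPdf, gaussianReal_real_halfLine, Set.indicator]
    rfl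
  rw [h]
  refine Measurable.indicator ?_ (measurable_snd (measurableSet_halfLine y))
  have h1 : Measurable fun q : ℝ × ℝ => gaussianPDFReal q.1 1 q.2 := by
    unfold gaussianPDFReal; fun_prop
  exact h1.div ((continuous_mass y).measurable.comp measurable_fst)

theorem measurable_latentPdf :
    Measurable fun q : (Fin p → ℝ) × (Fin n → ℝ) => latentPdf X Y q.2 q.1 := by
  have h : ∀ i, Measurable fun q : (Fin p → ℝ) × (Fin n → ℝ) =>
      tnPdf (X i ⬝ᵥ q.1) (Y i) (q.2 i) := by
    intro i
    have h1 : Measurable fun q : (Fin p → ℝ) × (Fin n → ℝ) => X i ⬝ᵥ q.1 := by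
      have : Continuous fun q : (Fin p → ℝ) × (Fin n → ℝ) => X i ⬝ᵥ q.1 := by fun_prop
      exact this.measurable
    have h2 : Measurable fun q : (Fin p → ℝ) × (Fin n → ℝ) => q.2 i := by fun_prop
    have h3 := (measurable_tnPdf (Y i)).comp (h1.prodMk h2)
    exact h3
  exact Finset.measurable_fun_prod _ fun i _ => h i

theorem measurable_latentPdf_left (β : Fin p → ℝ) : Measurable fun z => latentPdf X Y z β := by
  have h := (measurable_latentPdf (X := X) (Y := Y)).comp (measurable_prodMk_left (x := β))
  exact h

theorem latentPdf_nonneg (β : Fin p → ℝ) (z : Fin n → ℝ) : 0 ≤ latentPdf X Y z β :=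
  Finset.prod_nonneg fun _ _ => tnPdf_nonneg _ _ _

theorem continuous_condMean : Continuous (condMean X Q v) := by
  change Continuous fun z => (Sig X Q)⁻¹ *ᵥ (Xᵀ *ᵥ z + Q *ᵥ v)
  fun_prop

theorem measurable_condPdf :
    Measurable fun q : (Fin n → ℝ) × (Fin p → ℝ) => condPdf X Q v q.2 q.1 := by
  have h : Continuous fun q : (Fin n → ℝ) × (Fin p → ℝ) => (condMean X Q v q.1, q.2) :=
    (continuous_condMean.comp continuous_fst).prodMk continuous_snd
  exact ((continuous_mvNormalPdf _).comp h).measurable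

theorem measurable_condPdf_right (β : Fin p → ℝ) : Measurable fun z => condPdf X Q v β z := by
  have h := (measurable_condPdf (X := X) (Q := Q) (v := v)).comp
    (measurable_prodMk_right (y := β))
  exact h

theorem condPdf_nonneg (β : Fin p → ℝ) (z : Fin n → ℝ) : 0 ≤ condPdf X Q v β z :=
  mvNormalPdf_nonneg _ _ _

/-- The first step of the chain, from the coefficients to the latent vector. -/
def latentKernel (X : Matrix (Fin n) (Fin p) ℝ) (Y : Fin n → Bool) :
    Kernel (Fin p → ℝ) (Fin n → ℝ) :=
  Kernel.withDensity (Kernel.const _ volume) fun β z => ENNReal.ofReal (latentPdf X Y z β)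

/-- The second step of the chain, from the latent vector to the coefficients. -/
def coefKernel (X : Matrix (Fin n) (Fin p) ℝ) (Q : Matrix (Fin p) (Fin p) ℝ) (v : Fin p → ℝ) :
    Kernel (Fin n → ℝ) (Fin p → ℝ) :=
  Kernel.withDensity (Kernel.const _ volume) fun z β => ENNReal.ofReal (condPdf X Q v β z)

theorem latentKernel_apply (β : Fin p → ℝ) : latentKernel X Y β =
    volume.withDensity fun z => ENNReal.ofReal (latentPdf X Y z β) := by
  rw [latentKernel, Kernel.withDensity_apply _ measurable_latentPdf.ennreal_ofReal,
    Kernel.const_apply]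

theorem latentKernel_apply_eq_pi (β : Fin p → ℝ) :
    latentKernel X Y β = Measure.pi fun i => truncNormal (X i ⬝ᵥ β) (Y i) := by
  rw [latentKernel_apply]
  have h := pi_withDensity_ofReal (f := fun i => tnPdf (X i ⬝ᵥ β) (Y i))
    (fun i x => tnPdf_nonneg _ _ _) fun i => integrable_tnPdf _ _
  simp only [← truncNormal_eq_withDensity] at h
  rw [h]
  rfl

theorem coefKernel_apply (z : Fin n → ℝ) :
    coefKernel X Q v z = mvNormal (condMean X Q v z) (Sig X Q)⁻¹ := by
  rw [coefKernel, Kernel.withDensity_apply _ measurable_condPdf.ennreal_ofReal,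
    Kernel.const_apply]
  rfl

instance isMarkovKernel_latentKernel : IsMarkovKernel (latentKernel X Y) :=
  ⟨fun β => by rw [latentKernel_apply_eq_pi]; infer_instance⟩

theorem isMarkovKernel_coefKernel (hQ : Q.PosDef) : IsMarkovKernel (coefKernel X Q v) :=
  ⟨fun z => by rw [coefKernel_apply]; exact isProbabilityMeasure_mvNormal (posDef_Sig hQ).inv _⟩

theorem lintegral_latentPdf (β : Fin p → ℝ) :
    ∫⁻ z, ENNReal.ofReal (latentPdf X Y z β) = 1 := by
  have h : latentKernel X Y β Set.univ = 1 := measure_univ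
  rwa [latentKernel_apply, withDensity_apply _ MeasurableSet.univ, setLIntegral_univ] at h

theorem lintegral_condPdf (hQ : Q.PosDef) (z : Fin n → ℝ) :
    ∫⁻ β, ENNReal.ofReal (condPdf X Q v β z) = 1 := by
  have := isMarkovKernel_coefKernel (X := X) (v := v) hQ
  have h : coefKernel X Q v z Set.univ = 1 := measure_univ
  rwa [coefKernel_apply, mvNormal, withDensity_apply _ MeasurableSet.univ, setLIntegral_univ] at h

theorem integrable_latentPdf (β : Fin p → ℝ) : Integrable fun z => latentPdf X Y z β := by
  refine integrable_of_isFiniteMeasure_withDensity (measurable_latentPdf_left β) (latentPdf_nonneg β) ?_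
  rw [← latentKernel_apply]
  infer_instance

theorem latentMean_eq (β : Fin p → ℝ) : latentMean X Y β = tnMean X Y β := by
  funext i
  have h : ∫ z, z i ∂latentKernel X Y β = tnMean X Y β i := by
    have h1 := integral_comp_eval (μ := fun i => truncNormal (X i ⬝ᵥ β) (Y i)) (i := i)
      (f := fun x => x) aestronglyMeasurable_id
    rw [latentKernel_apply_eq_pi, h1, integral_id_truncNormal]
    rfl
  have hm : Measurable fun z => ENNReal.ofReal (latentPdf X Y z β) :=
    (measurable_latentPdf_left β).ennreal_ofReal
  rw [← h, latentKernel_apply, integral_withDensity_eq_integral_toReal_smul hm (by simp)]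
  refine integral_congr_ae (Filter.Eventually.of_forall fun z => ?_)
  simp only [smul_eq_mul]
  rw [ENNReal.toReal_ofReal (latentPdf_nonneg β z), mul_comm]

/-! ### The drift condition -/

section Drift

variable {b : Fin p → ℝ}

/-- The drift function of the latent chain. -/
def drift (X : Matrix (Fin n) (Fin p) ℝ) (Q : Matrix (Fin p) (Fin p) ℝ) (v b : Fin p → ℝ)
    (z : Fin n → ℝ) : ℝ := dist2 X Q (X *ᵥ (condMean X Q v z - b))

theorem drift_nonneg (hQ : Q.PosDef) (hX : X.rank = n) (z : Fin n → ℝ) :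
    0 ≤ drift X Q v b z := dist2_nonneg hQ hX _

theorem continuous_dist2 : Continuous (dist2 X Q) := continuous_quadratic _

theorem measurable_drift : Measurable (drift X Q v b) := by
  have h : Continuous fun z => X *ᵥ (condMean X Q v z - b) :=
    continuous_const.matrix_mulVec (continuous_condMean.sub continuous_const)
  exact (continuous_dist2.comp h).measurable

theorem mulVec_condMean_sub (w z : Fin n → ℝ) :
    X *ᵥ (condMean X Q v z - condMean X Q v w) = S X Q *ᵥ (z - w) := by
  rw [S_mulVec, condMean, condMean, ← mulVec_sub, mulVec_sub Xᵀ]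
  congr 2
  abel_nf

/-- Since the mode is the conditional mean given `tnMean X Y b`, the inverse of `S` cancels. What
remains is a quadratic form in independent coordinates under the latent draw. -/
theorem drift_eq (hQ : Q.PosDef) (hX : X.rank = n) (hb : IsPosteriorMode X Y Q v b)
    (z : Fin n → ℝ) :
    drift X Q v b z = (z - tnMean X Y b) ⬝ᵥ (S X Q *ᵥ (z - tnMean X Y b)) := by
  rw [drift]
  nth_rewrite 1 [← hb.condMean_tnMean hQ]
  rw [mulVec_condMean_sub, dist2_S_mulVec hQ hX]

theorem integrable_drift_latentKernel (hQ : Q.PosDef) (hX : X.rank = n)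
    (hb : IsPosteriorMode X Y Q v b) (β : Fin p → ℝ) :
    Integrable (drift X Q v b) (latentKernel X Y β) := by
  rw [latentKernel_apply_eq_pi, funext (drift_eq hQ hX hb)]
  exact integrable_pi_quadratic (fun i => memLp_id_truncNormal _ _) _ _

/-- Mean plus variance of a quadratic form in independent coordinates, each of variance at most one.
This version keeps the trace, as it appears in `H`. -/
theorem avg_drift_le_trace (hQ : Q.PosDef) (hX : X.rank = n) (hb : IsPosteriorMode X Y Q v b)
    (β : Fin p → ℝ) : avg (latentKernel X Y) (drift X Q v b) β ≤
      drift X Q v b (tnMean X Y β) + (S X Q).trace := by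
  rw [avg, latentKernel_apply_eq_pi, funext (drift_eq hQ hX hb),
    integral_pi_quadratic (fun i => memLp_id_truncNormal _ _)]
  simp only [integral_id_truncNormal]
  refine add_le_add le_rfl (Finset.sum_le_sum fun i _ => ?_)
  exact mul_le_of_le_one_right (S_diag_nonneg hQ hX i) (variance_truncNormal_le_one _ _)

theorem avg_drift_le (hQ : Q.PosDef) (hX : X.rank = n) (hb : IsPosteriorMode X Y Q v b)
    (β : Fin p → ℝ) : avg (latentKernel X Y) (drift X Q v b) β ≤
      lam X Q * dist2 X Q (X *ᵥ (β - b)) + n := by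
  refine (avg_drift_le_trace hQ hX hb β).trans (add_le_add ?_ (trace_S_le hQ))
  rw [drift]
  nth_rewrite 1 [← hb.condMean_tnMean hQ]
  rw [mulVec_condMean_sub]
  refine dist2_S_mulVec_le hQ hX fun i => ?_
  have := abs_mean_sub_mean_le (Y i) (X i ⬝ᵥ β) (X i ⬝ᵥ b)
  rw [mulVec_sub]
  exact this

theorem avg_drift_nonneg (hQ : Q.PosDef) (hX : X.rank = n) (β : Fin p → ℝ) :
    0 ≤ avg (latentKernel X Y) (drift X Q v b) β :=
  integral_nonneg fun z => drift_nonneg hQ hX z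

theorem dist2_mulVec (u : Fin p → ℝ) :
    dist2 X Q (X *ᵥ u) = u ⬝ᵥ ((Xᵀ * (S X Q)⁻¹ * X) *ᵥ u) := by
  rw [← mulVec_mulVec, ← mulVec_mulVec, dotProduct_transpose_mulVec, dist2]

theorem integrable_dist2_mvNormal (μ : Fin p → ℝ) {C : Matrix (Fin p) (Fin p) ℝ} (hC : C.PosDef) :
    Integrable (fun β => dist2 X Q (X *ᵥ (β - b))) (mvNormal μ C) := by
  simp only [dist2_mulVec]
  exact integrable_mvNormal_quadratic hC _ _ _

/-- The covariance term is `tr (Xᵀ S⁻¹ X Σ⁻¹)`, which by cyclicity of the trace is `tr (S⁻¹ S) = n`.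
-/
theorem avg_dist2_coefKernel (hQ : Q.PosDef) (hX : X.rank = n) (z : Fin n → ℝ) :
    avg (coefKernel X Q v) (fun β => dist2 X Q (X *ᵥ (β - b))) z = drift X Q v b z + n := by
  rw [avg, coefKernel_apply]
  simp only [dist2_mulVec]
  rw [integral_mvNormal_quadratic (posDef_Sig hQ).inv, ← dist2_mulVec, drift]
  congr 1
  rw [Matrix.mul_assoc, Matrix.mul_assoc, trace_mul_comm, Matrix.mul_assoc, Matrix.mul_assoc]
  change ((S X Q)⁻¹ * (X * ((Sig X Q)⁻¹ * Xᵀ))).trace = _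
  rw [← Matrix.mul_assoc X, ← S, nonsing_inv_mul _ (isUnit_det_of_posDef (posDef_S hQ hX)),
    trace_one, Fintype.card_fin]

/-- The chain of latent vectors. -/
def latentChain (X : Matrix (Fin n) (Fin p) ℝ) (Y : Fin n → Bool) (Q : Matrix (Fin p) (Fin p) ℝ)
    (v : Fin p → ℝ) : Kernel (Fin n → ℝ) (Fin n → ℝ) := latentKernel X Y ∘ₖ coefKernel X Q v

theorem isMarkovKernel_latentChain (hQ : Q.PosDef) : IsMarkovKernel (latentChain X Y Q v) := by
  have := isMarkovKernel_coefKernel (X := X) (v := v) hQ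
  unfold latentChain
  infer_instance

theorem integrable_drift_comp (hQ : Q.PosDef) (hX : X.rank = n) (hb : IsPosteriorMode X Y Q v b)
    {μ : Measure (Fin p → ℝ)} [IsFiniteMeasure μ]
    (hμ : Integrable (fun β => dist2 X Q (X *ᵥ (β - b))) μ) :
    Integrable (avg (latentKernel X Y) (drift X Q v b)) μ ∧
      Integrable (drift X Q v b) (latentKernel X Y ∘ₘ μ) := by
  have h : Integrable (avg (latentKernel X Y) (drift X Q v b)) μ :=
    ((hμ.const_mul (lam X Q)).add (integrable_const (n : ℝ))).mono'
      (measurable_avg _ measurable_drift).aestronglyMeasurable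
      (Filter.Eventually.of_forall fun β => by
        rw [Real.norm_of_nonneg (avg_drift_nonneg hQ hX β)]
        exact avg_drift_le hQ hX hb β)
  refine ⟨h, (Measure.integrable_comp_iff measurable_drift.aestronglyMeasurable).2
    ⟨Filter.Eventually.of_forall fun β => integrable_drift_latentKernel hQ hX hb β, ?_⟩⟩
  simp only [Real.norm_of_nonneg (drift_nonneg hQ hX _)]
  exact h

theorem integrable_drift_latentChain (hQ : Q.PosDef) (hX : X.rank = n)
    (hb : IsPosteriorMode X Y Q v b) (z : Fin n → ℝ) :
    Integrable (drift X Q v b) (latentChain X Y Q v z) := by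
  have := isMarkovKernel_coefKernel (X := X) (v := v) hQ
  rw [latentChain, Kernel.comp_apply]
  refine (integrable_drift_comp hQ hX hb ?_).2
  rw [coefKernel_apply]
  exact integrable_dist2_mvNormal _ (posDef_Sig hQ).inv

/-- The drift condition. -/
theorem integral_drift_latentChain_le (hQ : Q.PosDef) (hX : X.rank = n)
    (hb : IsPosteriorMode X Y Q v b) (z : Fin n → ℝ) :
    ∫ w, drift X Q v b w ∂latentChain X Y Q v z ≤ lam X Q * drift X Q v b z + L X Q := by
  have := isMarkovKernel_coefKernel (X := X) (v := v) hQ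
  have hi := integrable_drift_latentChain hQ hX hb z
  have hd : Integrable (fun β => dist2 X Q (X *ᵥ (β - b))) (coefKernel X Q v z) := by
    rw [coefKernel_apply]
    exact integrable_dist2_mvNormal _ (posDef_Sig hQ).inv
  rw [latentChain, Kernel.comp_apply] at hi ⊢
  rw [integral_comp_measure hi]
  have h1 := integral_mono (integrable_drift_comp hQ hX hb hd).1
    ((hd.const_mul (lam X Q)).add (integrable_const (n : ℝ))) (avg_drift_le hQ hX hb)
  rw [integral_add' (hd.const_mul (lam X Q)) (integrable_const (n : ℝ)), integral_const_mul] at h1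
  have h2 := avg_dist2_coefKernel (v := v) (b := b) hQ hX z
  rw [avg] at h2
  rw [h2] at h1
  simp only [integral_const, probReal_univ, one_smul] at h1
  refine h1.trans (le_of_eq ?_)
  rw [L]
  ring

end Drift

/-! ### The minorization condition -/

section Minorization

/-- The minorizing measure. -/
def minorizer (X : Matrix (Fin n) (Fin p) ℝ) (Y : Fin n → Bool) (Q : Matrix (Fin p) (Fin p) ℝ)
    (b : Fin p → ℝ) : Measure (Fin n → ℝ) := latentKernel X Y ∘ₘ mvNormal b (minPrec X Q)⁻¹

theorem isProbabilityMeasure_minorizer (hQ : Q.PosDef) (hX : X.rank = n) (b : Fin p → ℝ) :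
    IsProbabilityMeasure (minorizer X Y Q b) := by
  have := isProbabilityMeasure_mvNormal (posDef_minPrec hQ hX).inv b
  unfold minorizer
  infer_instance

theorem latentKernel_congr {β β' : Fin p → ℝ} (h : X *ᵥ β = X *ᵥ β') :
    latentKernel X Y β = latentKernel X Y β' := by
  have : ∀ i, X i ⬝ᵥ β = X i ⬝ᵥ β' := fun i => congrFun h i
  simp only [latentKernel_apply_eq_pi, this]

/-- Moving the centre within a fibre of `X` translates the coefficient draw along `ker X`, where the
latent kernel is constant. This frees the choice of centre in the minorization. -/
theorem latentKernel_comp_mvNormal_congr {C : Matrix (Fin p) (Fin p) ℝ} (hC : C.PosDef)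
    {μ μ' : Fin p → ℝ} (h : X *ᵥ μ = X *ᵥ μ') :
    latentKernel X Y ∘ₘ mvNormal μ C = latentKernel X Y ∘ₘ mvNormal μ' C := by
  have e : mvNormal μ' C = (mvNormal μ C).map fun x => (μ' - μ) + x := by
    rw [map_add_mvNormal hC, sub_add_cancel]
  ext s hs
  rw [Measure.bind_apply hs (Kernel.aemeasurable _), Measure.bind_apply hs (Kernel.aemeasurable _),
    e, lintegral_map (Kernel.measurable_coe _ hs) (by fun_prop)]
  refine lintegral_congr fun x => ?_
  have : X *ᵥ x = X *ᵥ (μ' - μ + x) := by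
    rw [mulVec_add, mulVec_sub, h, sub_self, zero_add]
  rw [latentKernel_congr this]

/-- The ratio of the normalizing constants is `2^(-n/2)`. The excess `2 * dist2` in
`nearest_quadratic_le`, halved in the exponent, costs at most a factor `e^(-d)`. -/
theorem eps_mul_mvNormalPdf_le (hQ : Q.PosDef) (hX : X.rank = n) {d : ℝ} {b μ : Fin p → ℝ}
    (hd : dist2 X Q (X *ᵥ (μ - b)) ≤ d) (x : Fin p → ℝ) :
    eps n d * mvNormalPdf b (minPrec X Q)⁻¹ x ≤
      mvNormalPdf (nearest X Q b μ) (Sig X Q)⁻¹ x := by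
  have hG := posDef_Sig (X := X) hQ
  have hM := posDef_minPrec hQ hX
  have hq := nearest_quadratic_le hQ hX b μ x
  have hdet : 0 < (Sig X Q)⁻¹.det := hG.inv.det_pos
  have e1 : (minPrec X Q)⁻¹.det = ((2 : ℝ) ^ n)⁻¹ * (Sig X Q)⁻¹.det := by
    rw [det_nonsing_inv, det_nonsing_inv, det_minPrec hQ hX, Ring.inverse_eq_inv', mul_inv]
  have e2 : Real.sqrt ((2 * Real.pi) ^ p * (minPrec X Q)⁻¹.det) =
      (2 : ℝ) ^ (-(n : ℝ) / 2) * Real.sqrt ((2 * Real.pi) ^ p * (Sig X Q)⁻¹.det) := by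
    have : (2 : ℝ) ^ (-(n : ℝ) / 2) = Real.sqrt (((2 : ℝ) ^ n)⁻¹) := by
      rw [Real.sqrt_eq_rpow, ← Real.rpow_natCast, ← Real.rpow_neg two_pos.le,
        ← Real.rpow_mul two_pos.le]
      congr 1
      ring
    rw [this, ← Real.sqrt_mul (by positivity), e1]
    congr 1
    ring
  unfold mvNormalPdf
  rw [nonsing_inv_nonsing_inv _ (isUnit_det_of_posDef hM),
    nonsing_inv_nonsing_inv _ (isUnit_det_of_posDef hG), e2, eps]
  have h2 : (0 : ℝ) < (2 : ℝ) ^ (-(n : ℝ) / 2) := by positivity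
  have e3 : ∀ s a c : ℝ, (2 : ℝ) ^ (-(n : ℝ) / 2) * a * (((2 : ℝ) ^ (-(n : ℝ) / 2) * s)⁻¹ * c) =
      s⁻¹ * (a * c) := by
    intro s a c
    rw [mul_inv]
    field_simp
  rw [e3, ← Real.exp_add]
  gcongr
  linarith

/-- The minorization condition. -/
theorem minorization (hQ : Q.PosDef) (hX : X.rank = n) {d : ℝ} {b : Fin p → ℝ}
    {z : Fin n → ℝ} (hd : drift X Q v b z ≤ d) :
    ENNReal.ofReal (eps n d) • minorizer X Y Q b ≤ latentChain X Y Q v z := by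
  have hG := posDef_Sig (X := X) hQ
  have heps : 0 ≤ eps n d := by unfold eps; positivity
  have hle : ENNReal.ofReal (eps n d) • mvNormal b (minPrec X Q)⁻¹ ≤
      mvNormal (nearest X Q b (condMean X Q v z)) (Sig X Q)⁻¹ := by
    have hm : Measurable fun x => ENNReal.ofReal (mvNormalPdf b (minPrec X Q)⁻¹ x) :=
      ((continuous_mvNormalPdf _).comp (Continuous.prodMk_right b)).measurable.ennreal_ofReal
    rw [mvNormal, mvNormal, ← withDensity_smul _ hm]
    refine withDensity_mono (Filter.Eventually.of_forall fun x => ?_)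
    rw [Pi.smul_apply, smul_eq_mul, ← ENNReal.ofReal_mul heps]
    exact ENNReal.ofReal_le_ofReal (eps_mul_mvNormalPdf_le hQ hX hd x)
  rw [latentChain, Kernel.comp_apply, coefKernel_apply,
    ← latentKernel_comp_mvNormal_congr hG.inv (mulVec_nearest hQ hX b (condMean X Q v z)),
    minorizer, ← Measure.bind_smul]
  refine Measure.le_iff.2 fun s hs => ?_
  rw [Measure.bind_apply hs (Kernel.aemeasurable _), Measure.bind_apply hs (Kernel.aemeasurable _)]
  exact lintegral_mono' hle le_rfl

end Minorization

end Chain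

end Probit

end

/-! ### The posterior distribution and stationarity -/

noncomputable section

namespace Probit

section Posterior

variable {n p : ℕ} {X : Matrix (Fin n) (Fin p) ℝ} {Y : Fin n → Bool}
  {Q : Matrix (Fin p) (Fin p) ℝ} {v : Fin p → ℝ}

theorem posterior_nonneg (hQ : Q.PosDef) (β : Fin p → ℝ) : 0 ≤ posterior X Y Q v β :=
  div_nonneg (weight_pos β).le (integral_weight_pos (v := v) hQ).le

theorem measurable_posterior : Measurable (posterior X Y Q v) :=
  (continuous_weight.div_const _).measurable

theorem integrable_posterior (hQ : Q.PosDef) : Integrable (posterior X Y Q v) :=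
  (integrable_weight hQ).div_const _

theorem mass_mul_tnPdf (θ : ℝ) (y : Bool) (t : ℝ) :
    mass θ y * tnPdf θ y t =
      (halfLine y).indicator 1 t * ((Real.sqrt (2 * Real.pi))⁻¹ *
        Real.exp (-(1 / 2) * ((t - θ) * (t - θ)))) := by
  have hm := (mass_pos θ y).ne'
  unfold tnPdf
  by_cases ht : t ∈ halfLine y
  · rw [Set.indicator_of_mem ht, Set.indicator_of_mem ht, gaussianReal_real_halfLine,
      mul_div_cancel₀ _ hm, gaussianPDFReal]
    simp only [NNReal.coe_one, mul_one, Pi.one_apply, one_mul]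
    congr 2
    ring
  · rw [Set.indicator_of_notMem ht, Set.indicator_of_notMem ht]
    ring

/-- Bayes' rule: the joint density of coefficients and latent vector in the two orders. -/
theorem exists_weight_mul_latentPdf (hQ : Q.PosDef) :
    ∃ g : (Fin n → ℝ) → ℝ, Measurable g ∧ (∀ z, 0 ≤ g z) ∧
      ∀ β z, weight X Y Q v β * latentPdf X Y z β = g z * condPdf X Q v β z := by
  have hG := posDef_Sig (X := X) hQ
  have hdet : 0 < (Sig X Q)⁻¹.det := hG.inv.det_pos
  refine ⟨fun z => (∏ i, (halfLine (Y i)).indicator (1 : ℝ → ℝ) (z i)) *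
    (Real.sqrt (2 * Real.pi))⁻¹ ^ n * Real.exp (-(1 / 2) * (z ⬝ᵥ z + v ⬝ᵥ (Q *ᵥ v) -
      condMean X Q v z ⬝ᵥ (Sig X Q *ᵥ condMean X Q v z))) *
    Real.sqrt ((2 * Real.pi) ^ p * (Sig X Q)⁻¹.det), ?_, fun z => ?_, fun β z => ?_⟩
  · have h1 : Measurable fun z : Fin n → ℝ =>
        ∏ i, (halfLine (Y i)).indicator (1 : ℝ → ℝ) (z i) := by
      refine Finset.measurable_fun_prod _ fun i _ => ?_
      have h : Measurable ((halfLine (Y i)).indicator (1 : ℝ → ℝ)) :=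
        measurable_one.indicator (measurableSet_halfLine (Y i))
      exact h.comp (measurable_pi_apply i)
    have h2 : Continuous fun z : Fin n → ℝ =>
        condMean X Q v z ⬝ᵥ (Sig X Q *ᵥ condMean X Q v z) :=
      (continuous_quadratic (Sig X Q)).comp continuous_condMean
    have h3 : Continuous fun z : Fin n → ℝ => z ⬝ᵥ z := by fun_prop
    have h4 : Continuous fun z : Fin n → ℝ => Real.exp (-(1 / 2) * (z ⬝ᵥ z + v ⬝ᵥ (Q *ᵥ v) -
        condMean X Q v z ⬝ᵥ (Sig X Q *ᵥ condMean X Q v z))) := by fun_prop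
    exact ((h1.mul_const _).mul h4.measurable).mul_const _
  · have : 0 ≤ ∏ i, (halfLine (Y i)).indicator (1 : ℝ → ℝ) (z i) :=
      Finset.prod_nonneg fun i _ => Set.indicator_nonneg (fun _ _ => zero_le_one) _
    positivity
  · have h1 : likelihood X Y β * latentPdf X Y z β =
        (∏ i, (halfLine (Y i)).indicator (1 : ℝ → ℝ) (z i)) * (Real.sqrt (2 * Real.pi))⁻¹ ^ n *
          Real.exp (-(1 / 2) * ((z - X *ᵥ β) ⬝ᵥ (z - X *ᵥ β))) := by
      rw [likelihood_eq, latentPdf, ← Finset.prod_mul_distrib]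
      simp only [mass_mul_tnPdf, Finset.prod_mul_distrib, Finset.prod_const, Finset.card_univ,
        Fintype.card_fin, ← Real.exp_sum, ← Finset.mul_sum]
      rw [mul_assoc]
      rfl
    have h2 := joint_quadratic (X := X) hQ v β z
    rw [weight, mul_right_comm, h1, prior, condPdf, mvNormalPdf,
      nonsing_inv_nonsing_inv _ (isUnit_det_of_posDef hG)]
    have h3 : ∀ a c e f s : ℝ, 0 < s → a * c * e * s * (s⁻¹ * f) = a * c * (e * f) := by
      intro a c e f s hs
      field_simp
    rw [h3 _ _ _ _ _ (by positivity), mul_assoc, ← Real.exp_add, ← Real.exp_add, ← mul_add,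
      ← mul_add, h2, add_comm (_ ⬝ᵥ (Sig X Q *ᵥ (β - condMean X Q v z)))]

/-- The posterior distribution. -/
def posteriorMeasure (X : Matrix (Fin n) (Fin p) ℝ) (Y : Fin n → Bool)
    (Q : Matrix (Fin p) (Fin p) ℝ) (v : Fin p → ℝ) : Measure (Fin p → ℝ) :=
  volume.withDensity fun β => ENNReal.ofReal (posterior X Y Q v β)

theorem isProbabilityMeasure_posteriorMeasure (hQ : Q.PosDef) :
    IsProbabilityMeasure (posteriorMeasure X Y Q v) := by
  constructor
  rw [posteriorMeasure, withDensity_apply _ MeasurableSet.univ, setLIntegral_univ,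
    ← ofReal_integral_eq_lintegral_ofReal (integrable_posterior hQ)
      (Filter.Eventually.of_forall (posterior_nonneg hQ))]
  simp only [posterior_eq]
  rw [integral_div, div_self (integral_weight_pos hQ).ne', ENNReal.ofReal_one]

/-- The marginal distribution of the latent vector. -/
def latentMarginal (X : Matrix (Fin n) (Fin p) ℝ) (Y : Fin n → Bool)
    (Q : Matrix (Fin p) (Fin p) ℝ) (v : Fin p → ℝ) : Measure (Fin n → ℝ) :=
  latentKernel X Y ∘ₘ posteriorMeasure X Y Q v

theorem isProbabilityMeasure_latentMarginal (hQ : Q.PosDef) :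
    IsProbabilityMeasure (latentMarginal X Y Q v) := by
  have := isProbabilityMeasure_posteriorMeasure (X := X) (Y := Y) (v := v) hQ
  unfold latentMarginal
  infer_instance

/-- The posterior distribution is recovered from the marginal of the latent vector. -/
theorem coefKernel_comp_latentMarginal (hQ : Q.PosDef) :
    coefKernel X Q v ∘ₘ latentMarginal X Y Q v = posteriorMeasure X Y Q v := by
  obtain ⟨g, hgm, hg0, hg⟩ := exists_weight_mul_latentPdf (X := X) (Y := Y) (v := v) hQ
  have hZ := integral_weight_pos (X := X) (Y := Y) (v := v) hQ
  have hg' : ∀ β z, ENNReal.ofReal (posterior X Y Q v β) * ENNReal.ofReal (latentPdf X Y z β) =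
      ENNReal.ofReal (g z / ∫ b, weight X Y Q v b) * ENNReal.ofReal (condPdf X Q v β z) := by
    intro β z
    rw [← ENNReal.ofReal_mul (posterior_nonneg hQ β),
      ← ENNReal.ofReal_mul (div_nonneg (hg0 z) hZ.le), posterior_eq, div_mul_eq_mul_div, hg,
      div_mul_eq_mul_div]
  have h1 : latentMarginal X Y Q v =
      volume.withDensity fun z => ENNReal.ofReal (g z / ∫ b, weight X Y Q v b) :=
    comp_withDensity_eq measurable_latentPdf.ennreal_ofReal latentKernel_apply
      measurable_posterior.ennreal_ofReal measurable_condPdf.ennreal_ofReal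
      (lintegral_condPdf hQ) hg'
  rw [h1]
  exact comp_withDensity_eq measurable_condPdf.ennreal_ofReal coefKernel_apply
    (hgm.div_const _).ennreal_ofReal measurable_latentPdf.ennreal_ofReal
    lintegral_latentPdf fun z β => (hg' β z).symm

theorem latentChain_comp_latentMarginal (hQ : Q.PosDef) :
    latentChain X Y Q v ∘ₘ latentMarginal X Y Q v = latentMarginal X Y Q v := by
  rw [latentChain, ← Measure.comp_assoc, coefKernel_comp_latentMarginal hQ]
  rfl

/-- Domination by a multiple of the prior gives the posterior finite second moments, hence
integrability of the drift function under the stationary law. -/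
theorem posteriorMeasure_le (hQ : Q.PosDef) :
    ∃ c : ENNReal, c ≠ ⊤ ∧ posteriorMeasure X Y Q v ≤ c • mvNormal v Q⁻¹ := by
  have hZ := integral_weight_pos (X := X) (Y := Y) (v := v) hQ
  have hm : Measurable fun x => ENNReal.ofReal (mvNormalPdf v Q⁻¹ x) :=
    ((continuous_mvNormalPdf _).comp (Continuous.prodMk_right v)).measurable.ennreal_ofReal
  refine ⟨ENNReal.ofReal (Real.sqrt ((2 * Real.pi) ^ p * Q⁻¹.det) / ∫ b, weight X Y Q v b),
    ENNReal.ofReal_ne_top, ?_⟩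
  rw [posteriorMeasure, mvNormal, ← withDensity_smul _ hm]
  refine withDensity_mono (Filter.Eventually.of_forall fun β => ?_)
  rw [Pi.smul_apply, smul_eq_mul, ← ENNReal.ofReal_mul (by positivity)]
  refine ENNReal.ofReal_le_ofReal ?_
  rw [div_mul_eq_mul_div, ← prior_eq hQ, posterior_eq]
  gcongr
  exact weight_le_prior β

variable {b : Fin p → ℝ}

theorem integrable_drift_latentMarginal (hQ : Q.PosDef) (hX : X.rank = n)
    (hb : IsPosteriorMode X Y Q v b) :
    Integrable (drift X Q v b) (latentMarginal X Y Q v) := by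
  have := isProbabilityMeasure_posteriorMeasure (X := X) (Y := Y) (v := v) hQ
  obtain ⟨c, hc, hle⟩ := posteriorMeasure_le (X := X) (Y := Y) (v := v) hQ
  exact (integrable_drift_comp hQ hX hb
    (((integrable_dist2_mvNormal v hQ.inv).smul_measure hc).mono_measure hle)).2

/-- Integrating the drift inequality against the stationary law gives `I ≤ λ I + L`, which can be
solved for `I` because `I` is a genuine integral. -/
theorem integral_drift_latentMarginal_le (hQ : Q.PosDef) (hX : X.rank = n)
    (hb : IsPosteriorMode X Y Q v b) :
    ∫ z, drift X Q v b z ∂latentMarginal X Y Q v ≤ L X Q / (1 - lam X Q) := by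
  have := isProbabilityMeasure_latentMarginal (X := X) (Y := Y) (v := v) hQ
  have := isMarkovKernel_latentChain (X := X) (Y := Y) (v := v) hQ
  have hi := integrable_drift_latentMarginal hQ hX hb
  have hdr := integral_drift_latentChain_le hQ hX hb
  have hbd := (hi.const_mul (lam X Q)).add (integrable_const (L X Q))
  have h1 : ∫ z, drift X Q v b z ∂latentMarginal X Y Q v =
      ∫ z, avg (latentChain X Y Q v) (drift X Q v b) z ∂latentMarginal X Y Q v := by
    have hi' := hi
    rw [← latentChain_comp_latentMarginal hQ] at hi'
    rw [← integral_comp_measure hi', latentChain_comp_latentMarginal hQ]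
  have h2 : Integrable (avg (latentChain X Y Q v) (drift X Q v b)) (latentMarginal X Y Q v) :=
    hbd.mono' (measurable_avg _ measurable_drift).aestronglyMeasurable
      (Filter.Eventually.of_forall fun z => by
        have h0 : 0 ≤ avg (latentChain X Y Q v) (drift X Q v b) z :=
          integral_nonneg fun w => drift_nonneg hQ hX w
        rw [Real.norm_of_nonneg h0]
        exact hdr z)
  have h3 := integral_mono h2 hbd hdr
  rw [integral_add' (hi.const_mul (lam X Q)) (integrable_const (L X Q)), integral_const_mul,
    integral_const, probReal_univ, one_smul, ← h1] at h3
  rw [le_div_iff₀ (by linarith [lam_lt_one hQ hX])]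
  linarith

end Posterior

/-! ### Transition densities -/

section Transition

variable {n p : ℕ} {X : Matrix (Fin n) (Fin p) ℝ} {Y : Fin n → Bool}
  {Q : Matrix (Fin p) (Fin p) ℝ} {v : Fin p → ℝ}

theorem condPdf_le (β : Fin p → ℝ) (z : Fin n → ℝ) (hQ : Q.PosDef) :
    condPdf X Q v β z ≤ (Real.sqrt ((2 * Real.pi) ^ p * (Sig X Q)⁻¹.det))⁻¹ := by
  have hG := posDef_Sig (X := X) hQ
  rw [condPdf, mvNormalPdf, nonsing_inv_nonsing_inv _ (isUnit_det_of_posDef hG)]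
  refine mul_le_of_le_one_right (by positivity) (Real.exp_le_one_iff.2 ?_)
  have := quadratic_nonneg hG.posSemidef (β - condMean X Q v z)
  linarith

theorem integrable_condPdf_mul_latentPdf (hQ : Q.PosDef) (β β' : Fin p → ℝ) :
    Integrable fun z => condPdf X Q v β' z * latentPdf X Y z β := by
  exact (integrable_latentPdf β).bdd_mul (measurable_condPdf_right β').aestronglyMeasurable
    (Filter.Eventually.of_forall fun z => by
      rw [Real.norm_of_nonneg (condPdf_nonneg β' z)]; exact condPdf_le β' z hQ)

theorem kAC_nonneg (β β' : Fin p → ℝ) : 0 ≤ kAC X Y Q v β β' :=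
  integral_nonneg fun z => mul_nonneg (condPdf_nonneg β' z) (latentPdf_nonneg β z)

/-- This uniform bound makes the integrand in the recursion for `kACStep` integrable at every point,
so the Bochner integral there is never a default value. -/
theorem kAC_le (hQ : Q.PosDef) (β β' : Fin p → ℝ) :
    kAC X Y Q v β β' ≤ (Real.sqrt ((2 * Real.pi) ^ p * (Sig X Q)⁻¹.det))⁻¹ := by
  have h1 : ∫ z, latentPdf X Y z β = 1 := by
    rw [integral_eq_lintegral_of_nonneg_ae (Filter.Eventually.of_forall (latentPdf_nonneg β))
      (integrable_latentPdf β).aestronglyMeasurable, lintegral_latentPdf, ENNReal.toReal_one]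
  calc kAC X Y Q v β β' ≤ ∫ z, (Real.sqrt ((2 * Real.pi) ^ p * (Sig X Q)⁻¹.det))⁻¹ *
        latentPdf X Y z β :=
      integral_mono (integrable_condPdf_mul_latentPdf hQ β β')
        ((integrable_latentPdf β).const_mul _) fun z =>
          mul_le_mul_of_nonneg_right (condPdf_le β' z hQ) (latentPdf_nonneg β z)
    _ = _ := by rw [integral_const_mul, h1, mul_one]

theorem measurable_kAC :
    Measurable fun q : (Fin p → ℝ) × (Fin p → ℝ) => kAC X Y Q v q.1 q.2 := by
  have h : Measurable fun r : ((Fin p → ℝ) × (Fin p → ℝ)) × (Fin n → ℝ) =>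
      condPdf X Q v r.1.2 r.2 * latentPdf X Y r.2 r.1.1 := by
    have h1 : Measurable fun r : ((Fin p → ℝ) × (Fin p → ℝ)) × (Fin n → ℝ) => (r.2, r.1.2) := by
      fun_prop
    have h2 : Measurable fun r : ((Fin p → ℝ) × (Fin p → ℝ)) × (Fin n → ℝ) => (r.1.1, r.2) := by
      fun_prop
    have h3 := (measurable_condPdf (X := X) (Q := Q) (v := v)).comp h1
    have h4 := (measurable_latentPdf (X := X) (Y := Y)).comp h2
    exact h3.mul h4
  have h5 := h.stronglyMeasurable.integral_prod_right' (ν := volume)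
  exact h5.measurable

theorem measurable_kAC_left (β : Fin p → ℝ) : Measurable fun β' => kAC X Y Q v β β' := by
  have h := (measurable_kAC (X := X) (Y := Y) (Q := Q) (v := v)).comp
    (measurable_prodMk_left (x := β))
  exact h

theorem measurable_kAC_right (β' : Fin p → ℝ) : Measurable fun β => kAC X Y Q v β β' := by
  have h := (measurable_kAC (X := X) (Y := Y) (Q := Q) (v := v)).comp
    (measurable_prodMk_right (y := β'))
  exact h

theorem coefKernel_comp_latentKernel_apply (hQ : Q.PosDef) (β : Fin p → ℝ) :
    (coefKernel X Q v ∘ₖ latentKernel X Y) β =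
      volume.withDensity fun β' => ENNReal.ofReal (kAC X Y Q v β β') := by
  rw [Kernel.comp_apply, latentKernel_apply, comp_withDensity measurable_condPdf.ennreal_ofReal
    coefKernel_apply (measurable_latentPdf_left β).ennreal_ofReal]
  congr 1
  funext β'
  rw [kAC, ofReal_integral_eq_lintegral_ofReal (integrable_condPdf_mul_latentPdf hQ β β')
    (Filter.Eventually.of_forall fun z => mul_nonneg (condPdf_nonneg β' z) (latentPdf_nonneg β z))]
  refine lintegral_congr fun z => ?_
  rw [ENNReal.ofReal_mul (condPdf_nonneg β' z), mul_comm]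
  rfl

/-- The distribution after `m` steps of the latent chain. -/
def latentLaw (X : Matrix (Fin n) (Fin p) ℝ) (Y : Fin n → Bool) (Q : Matrix (Fin p) (Fin p) ℝ)
    (v : Fin p → ℝ) (m : ℕ) (μ : Measure (Fin n → ℝ)) : Measure (Fin n → ℝ) :=
  (fun μ => latentChain X Y Q v ∘ₘ μ)^[m] μ

theorem isProbabilityMeasure_latentLaw (hQ : Q.PosDef) (m : ℕ) (μ : Measure (Fin n → ℝ))
    [hμ : IsProbabilityMeasure μ] : IsProbabilityMeasure (latentLaw X Y Q v m μ) := by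
  have := isMarkovKernel_latentChain (X := X) (Y := Y) (v := v) hQ
  induction m with
  | zero => exact hμ
  | succ m ih =>
    rw [latentLaw, Function.iterate_succ_apply']
    rw [latentLaw] at ih
    infer_instance

theorem integral_latentLaw (hQ : Q.PosDef) (m : ℕ) (μ : Measure (Fin n → ℝ))
    [IsProbabilityMeasure μ] {g : (Fin n → ℝ) → ℝ} (hg : Measurable g) (hg1 : ∀ z, |g z| ≤ 1) :
    ∫ z, g z ∂latentLaw X Y Q v m μ = ∫ z, (avg (latentChain X Y Q v))^[m] g z ∂μ := by
  have := isMarkovKernel_latentChain (X := X) (Y := Y) (v := v) hQ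
  induction m generalizing g with
  | zero => rfl
  | succ m ih =>
    have h1 : latentLaw X Y Q v (m + 1) μ = latentChain X Y Q v ∘ₘ latentLaw X Y Q v m μ := by
      rw [latentLaw, Function.iterate_succ_apply']; rfl
    have := isProbabilityMeasure_latentLaw (X := X) (Y := Y) (v := v) hQ m μ
    rw [h1, integral_comp_measure (integrable_of_abs_le_one hg hg1),
      ih (measurable_avg _ hg) (abs_avg_le_one _ hg1), Function.iterate_succ_apply]

/-- The `m`-step transition density. -/
theorem kACStep_spec (hQ : Q.PosDef) (m : ℕ) (β : Fin p → ℝ) :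
    (∀ β', 0 ≤ kACStep X Y Q v (m + 1) β β') ∧ Measurable (kACStep X Y Q v (m + 1) β) ∧
      (volume.withDensity fun β' => ENNReal.ofReal (kACStep X Y Q v (m + 1) β β')) =
        coefKernel X Q v ∘ₘ latentLaw X Y Q v m (latentKernel X Y β) := by
  induction m with
  | zero =>
    refine ⟨kAC_nonneg β, measurable_kAC_left β, ?_⟩
    have := coefKernel_comp_latentKernel_apply (X := X) (Y := Y) (v := v) hQ β
    rw [Kernel.comp_apply] at this
    exact this.symm
  | succ m ih =>
    obtain ⟨h0, hm, he⟩ := ih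
    have := isMarkovKernel_coefKernel (X := X) (v := v) hQ
    have := isProbabilityMeasure_latentLaw (X := X) (Y := Y) (v := v) hQ m (latentKernel X Y β)
    have hi : Integrable (kACStep X Y Q v (m + 1) β) :=
      integrable_of_isFiniteMeasure_withDensity hm h0 (by rw [he]; infer_instance)
    have hint : ∀ β', Integrable fun c => kACStep X Y Q v (m + 1) β c * kAC X Y Q v c β' :=
      fun β' => hi.mul_bdd (measurable_kAC_right β').aestronglyMeasurable
        (Filter.Eventually.of_forall fun c => by
          rw [Real.norm_of_nonneg (kAC_nonneg c β')]; exact kAC_le hQ c β')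
    have h0' : ∀ β' c, 0 ≤ kACStep X Y Q v (m + 1) β c * kAC X Y Q v c β' := fun β' c =>
      mul_nonneg (h0 c) (kAC_nonneg c β')
    refine ⟨fun β' => integral_nonneg (h0' β'), ?_, ?_⟩
    · have h : Measurable fun r : (Fin p → ℝ) × (Fin p → ℝ) =>
          kACStep X Y Q v (m + 1) β r.2 * kAC X Y Q v r.2 r.1 := by
        have h1 := (measurable_kAC (X := X) (Y := Y) (Q := Q) (v := v)).comp measurable_swap
        exact (hm.comp measurable_snd).mul h1
      have h2 := h.stronglyMeasurable.integral_prod_right' (ν := volume)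
      exact h2.measurable
    · have h1 : latentLaw X Y Q v (m + 1) (latentKernel X Y β) =
          latentChain X Y Q v ∘ₘ latentLaw X Y Q v m (latentKernel X Y β) := by
        rw [latentLaw, Function.iterate_succ_apply']; rfl
      -- Reassociating coefficient, latent, coefficient draws exposes the kernel with density `kAC`
      -- acting on the law of the previous step.
      rw [h1, latentChain, ← Measure.comp_assoc, ← he, Measure.comp_assoc,
        comp_withDensity measurable_kAC.ennreal_ofReal (coefKernel_comp_latentKernel_apply hQ)
          hm.ennreal_ofReal]
      congr 1
      funext β'
      rw [kACStep, ofReal_integral_eq_lintegral_ofReal (hint β')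
        (Filter.Eventually.of_forall (h0' β'))]
      exact lintegral_congr fun c => ENNReal.ofReal_mul (h0 c)

end Transition

/-! ### The convergence bound -/

section Convergence

variable {n p : ℕ} {X : Matrix (Fin n) (Fin p) ℝ} {Y : Fin n → Bool}
  {Q : Matrix (Fin p) (Fin p) ℝ} {v b : Fin p → ℝ} {d r : ℝ}

theorem eps_pos : 0 < eps n d := by unfold eps; positivity

theorem eps_le_exp : eps n d ≤ Real.exp (-d) := by
  unfold eps
  refine mul_le_of_le_one_left (Real.exp_pos _).le
    (Real.rpow_le_one_of_one_le_of_nonpos one_le_two ?_)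
  have : (0 : ℝ) ≤ n := Nat.cast_nonneg n
  linarith

theorem two_mul_L_le (hQ : Q.PosDef) (hX : X.rank = n) :
    2 * L X Q ≤ 2 * L X Q / (1 - lam X Q) := by
  have h1 := lam_lt_one hQ hX
  have h0 := lam_nonneg (X := X) (Q := Q)
  have hL := L_nonneg (X := X) (Q := Q)
  exact le_div_self (by linarith) (by linarith) (by linarith)

theorem eps_lt_one (hd : 0 < d) : eps n d < 1 :=
  eps_le_exp.trans_lt (by rw [Real.exp_lt_one_iff]; linarith)

theorem rhoHat_nonneg (hd : 0 < d) (l c : ℝ) : 0 ≤ rhoHat l c (eps n d) d r :=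
  le_max_of_le_left (Real.rpow_nonneg (by linarith [eps_lt_one (n := n) hd]) r)

/-- The oscillation bound for the latent chain. -/
theorem avg_latentChain_iterate_sub_le (hQ : Q.PosDef) (hX : X.rank = n)
    (hb : IsPosteriorMode X Y Q v b) (hd : 2 * L X Q / (1 - lam X Q) < d)
    {g : (Fin n → ℝ) → ℝ} (hg : Measurable g) (hg1 : ∀ z, |g z| ≤ 1) (m : ℕ) (z w : Fin n → ℝ) :
    (avg (latentChain X Y Q v))^[m] g z - (avg (latentChain X Y Q v))^[m] g w ≤
      rhoHat (lam X Q) (L X Q) (eps n d) d r ^ m * (2 + drift X Q v b z + drift X Q v b w) := by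
  have := isMarkovKernel_latentChain (X := X) (Y := Y) (v := v) hQ
  have hl0 := lam_nonneg (X := X) (Q := Q)
  have hl1 := lam_lt_one hQ hX
  have hL0 := L_nonneg (X := X) (Q := Q)
  have hLd := (two_mul_L_le hQ hX).trans_lt hd
  have hd0 : 0 < d := by linarith
  -- For `n = 0` one may have `A = 1`, which `exists_rate_exponent` excludes; but then the latent
  -- space is a single point.
  rcases Nat.eq_zero_or_pos n with hn | hn
  · subst hn
    rw [Subsingleton.elim z w, sub_self]
    have := drift_nonneg (v := v) (b := b) hQ hX w
    exact mul_nonneg (pow_nonneg (rhoHat_nonneg hd0 _ _) m) (by linarith)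
  · have hL1 : 1 ≤ L X Q := by
      have h1 : (1 : ℝ) ≤ n := by exact_mod_cast hn
      rw [L]
      nlinarith
    have hν := isProbabilityMeasure_minorizer (Y := Y) hQ hX b
    have hε0 := eps_pos (n := n) (d := d)
    have hε1 := eps_lt_one (n := n) hd0
    have hden : 0 < 1 + 2 * L X Q + lam X Q * d := by positivity
    -- From `1 + d ≤ e^d`. Together with `d > 2 L ≥ 2` it gives `(1 - ε) (1 + d) ≥ 1`, the source of
    -- the condition `1 ≤ q * (A / γ)`.
    have hε : eps n d * (1 + d) ≤ 1 := by
      have h1 := eps_le_exp (n := n) (d := d)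
      have h2 : 1 + d ≤ Real.exp d := by linarith [Real.add_one_le_exp d]
      calc eps n d * (1 + d) ≤ Real.exp (-d) * Real.exp d := by gcongr
        _ = 1 := by rw [← Real.exp_add, neg_add_cancel, Real.exp_zero]
    have hγ1 : (1 + 2 * L X Q + lam X Q * d) / (1 + d) < 1 := by
      rw [div_lt_iff₀ (by linarith) ] at hd
      · rw [div_lt_one (by linarith)]
        linarith
    obtain ⟨s, hs0, hs1, h1, h2⟩ := exists_rate_exponent
      (γ := (1 + 2 * L X Q + lam X Q * d) / (1 + d)) (A := 1 + 2 * (lam X Q * d + L X Q))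
      (q := 1 - eps n d) (r := r) (by positivity) hγ1
      (by have := mul_nonneg hl0 hd0.le; linarith) (by linarith) (by linarith) (by
        rw [div_div_eq_mul_div, mul_div_assoc', le_div_iff₀ hden, one_mul]
        have h3 := mul_nonneg hl0 hd0.le
        have h4 : 1 ≤ (1 - eps n d) * (1 + d) := by linarith
        calc 1 + 2 * L X Q + lam X Q * d ≤ 1 * (1 + 2 * (lam X Q * d + L X Q)) := by linarith
          _ ≤ (1 - eps n d) * (1 + d) * (1 + 2 * (lam X Q * d + L X Q)) := by gcongr
          _ = _ := by ring)
    exact avg_iterate_sub_le (drift_nonneg hQ hX) (integrable_drift_latentChain hQ hX hb)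
      (integral_drift_latentChain_le hQ hX hb) (fun z hz => minorization hQ hX hz) hl0 hl1 hL0
      hd0.le hε0 hε1 hs0 hs1 h1 h2 hg hg1 m z w

theorem integral_withDensity_ofReal {α : Type*} [MeasurableSpace α] {μ : Measure α} {k f : α → ℝ}
    (hk : Measurable k) (hk0 : ∀ x, 0 ≤ k x) :
    ∫ x, f x ∂μ.withDensity (fun x => ENNReal.ofReal (k x)) = ∫ x, k x * f x ∂μ := by
  rw [integral_withDensity_eq_integral_toReal_smul hk.ennreal_ofReal (by simp)]
  simp only [ENNReal.toReal_ofReal (hk0 _), smul_eq_mul]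

/-- The last coefficient draw is absorbed into the test function. The oscillation bound is then
integrated over the first latent draw and the stationary latent law, and their means of the drift
function supply the terms of `H`. -/
theorem integral_sub_integral_posterior_le (hQ : Q.PosDef) (hX : X.rank = n)
    (hb : IsPosteriorMode X Y Q v b) (hd : 2 * L X Q / (1 - lam X Q) < d)
    {f : (Fin p → ℝ) → ℝ} (hf : Measurable f) (hf1 : ∀ β, |f β| ≤ 1) (m : ℕ) (β : Fin p → ℝ) :
    ∫ β', f β' ∂(coefKernel X Q v ∘ₘ latentLaw X Y Q v m (latentKernel X Y β)) -
      ∫ β', f β' ∂posteriorMeasure X Y Q v ≤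
    rhoHat (lam X Q) (L X Q) (eps n d) d r ^ m * (2 + L X Q / (1 - lam X Q) +
      (S X Q).trace + drift X Q v b (tnMean X Y β)) := by
  have := isMarkovKernel_latentChain (X := X) (Y := Y) (v := v) hQ
  have := isMarkovKernel_coefKernel (X := X) (v := v) hQ
  have := isProbabilityMeasure_latentMarginal (X := X) (Y := Y) (v := v) hQ
  have := isProbabilityMeasure_latentLaw (X := X) (Y := Y) (v := v) hQ m (latentKernel X Y β)
  have hgm := measurable_avg (coefKernel X Q v) hf
  have hg1 := abs_avg_le_one (coefKernel X Q v) hf1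
  have hfix : latentLaw X Y Q v m (latentMarginal X Y Q v) = latentMarginal X Y Q v :=
    Function.iterate_fixed (latentChain_comp_latentMarginal hQ) m
  rw [← coefKernel_comp_latentMarginal hQ, integral_comp_measure (integrable_of_abs_le_one hf hf1),
    integral_comp_measure (integrable_of_abs_le_one hf hf1), integral_latentLaw hQ m _ hgm hg1,
    ← hfix, integral_latentLaw hQ m _ hgm hg1]
  have hiter : ∀ m : ℕ, Measurable ((avg (latentChain X Y Q v))^[m] (avg (coefKernel X Q v) f)) ∧
      ∀ z, |(avg (latentChain X Y Q v))^[m] (avg (coefKernel X Q v) f) z| ≤ 1 := by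
    intro m
    induction m with
    | zero => exact ⟨hgm, hg1⟩
    | succ m ih =>
      rw [Function.iterate_succ_apply']
      exact ⟨measurable_avg _ ih.1, abs_avg_le_one _ ih.2⟩
  have hosc := avg_latentChain_iterate_sub_le (r := r) hQ hX hb hd hgm hg1 m
  have hd0 : 0 < d := by
    have := (two_mul_L_le hQ hX).trans_lt hd
    linarith [L_nonneg (X := X) (Q := Q)]
  have hρ := pow_nonneg (rhoHat_nonneg (n := n) (r := r) hd0 (lam X Q) (L X Q)) m
  generalize rhoHat (lam X Q) (L X Q) (eps n d) d r ^ m = ρ at *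
  refine (integral_sub_integral_le_of_affine (a := ρ * 2) (b := ρ) one_pos probReal_univ
    probReal_univ (integrable_of_abs_le_one (hiter m).1 (hiter m).2)
    (integrable_of_abs_le_one (hiter m).1 (hiter m).2)
    (integrable_drift_latentKernel hQ hX hb β) (integrable_drift_latentMarginal hQ hX hb)
    (fun z w => (hosc z w).trans (le_of_eq (by ring)))).trans ?_
  have h1 := avg_drift_le_trace hQ hX hb β
  have h2 := integral_drift_latentMarginal_le hQ hX hb
  rw [avg] at h1
  rw [mul_one, ← mul_add]
  exact mul_le_mul_of_nonneg_left (by linarith) hρ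

theorem integral_abs_kACStep_sub_posterior_le (hQ : Q.PosDef) (hX : X.rank = n)
    (hb : IsPosteriorMode X Y Q v b) (hd : 2 * L X Q / (1 - lam X Q) < d) (m : ℕ)
    (β : Fin p → ℝ) :
    Integrable (fun β' => |kACStep X Y Q v (m + 1) β β' - posterior X Y Q v β'|) ∧
      ∫ β', |kACStep X Y Q v (m + 1) β β' - posterior X Y Q v β'| ≤
        H X Y Q v b β * rhoHat (lam X Q) (L X Q) (eps n d) d r ^ m := by
  obtain ⟨h0, hm, he⟩ := kACStep_spec (X := X) (Y := Y) (v := v) hQ m β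
  have := isMarkovKernel_coefKernel (X := X) (v := v) hQ
  have := isProbabilityMeasure_latentLaw (X := X) (Y := Y) (v := v) hQ m (latentKernel X Y β)
  have hi : Integrable (kACStep X Y Q v (m + 1) β) :=
    integrable_of_isFiniteMeasure_withDensity hm h0 (by rw [he]; infer_instance)
  have hp := integrable_posterior (X := X) (Y := Y) (v := v) hQ
  refine ⟨(hi.sub hp).abs, ?_⟩
  -- The sign of the difference of densities is the extremal test function for the `L¹` distance.
  obtain ⟨f, hf⟩ : ∃ f : (Fin p → ℝ) → ℝ, f = fun β' =>
      if posterior X Y Q v β' ≤ kACStep X Y Q v (m + 1) β β' then (1 : ℝ) else -1 := ⟨_, rfl⟩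
  have hfm : Measurable f := by
    rw [hf]
    exact Measurable.ite (measurableSet_le measurable_posterior hm) measurable_const
      measurable_const
  have hf1 : ∀ β', |f β'| ≤ 1 := by
    intro β'
    rw [hf]
    dsimp only
    split_ifs <;> simp
  have hbdd : ∀ᵐ β', ‖f β'‖ ≤ 1 := Filter.Eventually.of_forall hf1
  have e : ∀ β', |kACStep X Y Q v (m + 1) β β' - posterior X Y Q v β'| =
      kACStep X Y Q v (m + 1) β β' * f β' - posterior X Y Q v β' * f β' := by
    intro β'
    rw [hf]
    dsimp only
    split_ifs with h
    · rw [abs_of_nonneg (by linarith)]; ring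
    · rw [abs_of_neg (by linarith)]; ring
  have hmain := integral_sub_integral_posterior_le (r := r) hQ hX hb hd hfm hf1 m β
  rw [← he, posteriorMeasure, integral_withDensity_ofReal hm h0,
    integral_withDensity_ofReal measurable_posterior (posterior_nonneg hQ)] at hmain
  simp only [e]
  rw [integral_sub (hi.mul_bdd hfm.aestronglyMeasurable hbdd)
    (hp.mul_bdd hfm.aestronglyMeasurable hbdd)]
  refine hmain.trans (le_of_eq ?_)
  rw [H, sqNorm_invSqrt_mulVec (posDef_S hQ hX), latentMean_eq, mul_comm]
  rfl

end Convergence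

end Probit

end

theorem mainTheorem9 (n p : ℕ) (X : Matrix (Fin n) (Fin p) ℝ) (Y : Fin n → Bool)
    (Q : Matrix (Fin p) (Fin p) ℝ) (v : Fin p → ℝ)
    (hQ : Q.PosDef) (hX : X.rank = n) :
    (∃! b, Probit.IsPosteriorMode X Y Q v b) ∧
    Probit.lam X Q < 1 ∧
    (∀ (β : Fin p → ℝ) (i : Fin n),
      Probit.latentMean X Y β i =
        X i ⬝ᵥ β +
          if Y i then Probit.stdPdf (X i ⬝ᵥ β) / Probit.stdCdf (X i ⬝ᵥ β)
          else -(Probit.stdPdf (X i ⬝ᵥ β) / (1 - Probit.stdCdf (X i ⬝ᵥ β)))) ∧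
    ∀ Bhat : Fin p → ℝ, Probit.IsPosteriorMode X Y Q v Bhat →
      ∀ d : ℝ, 2 * Probit.L X Q / (1 - Probit.lam X Q) < d →
      ∀ r : ℝ, 0 < r → r < 1 →
      ∀ m : ℕ, 1 ≤ m → ∀ β : Fin p → ℝ,
        Integrable (fun β' => |Probit.kACStep X Y Q v m β β' - Probit.posterior X Y Q v β'|) ∧
        ∫ β', |Probit.kACStep X Y Q v m β β' - Probit.posterior X Y Q v β'| ≤
          Probit.H X Y Q v Bhat β *
            Probit.rhoHat (Probit.lam X Q) (Probit.L X Q) (Probit.eps n d) d r ^ (m - 1) := by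
  refine ⟨?_, Probit.lam_lt_one hQ hX, fun β i => ?_, ?_⟩
  · obtain ⟨b, hb⟩ := Probit.exists_isPosteriorMode (X := X) (Y := Y) (v := v) hQ
    exact ⟨b, hb, fun c hc => hc.unique hQ hb⟩
  · rw [Probit.latentMean_eq]
    rfl
  · intro b hb d hd r _ _ m hm β
    obtain ⟨m, rfl⟩ : ∃ k, m = k + 1 := ⟨m - 1, by omega⟩
    exact Probit.integral_abs_kACStep_sub_posterior_le hQ hX hb hd m β
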